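/- Let $v_1,v_2,v_3\in\mathbb R^2$ be distinct and non-collinear, let $\Delta=\mathrm{co}\{v_1,v_2,v_3\}$, let $q$ be the circumcenter of $\Delta$ (so $|v_1-q|=|v_2-q|=|v_3-q|$), and let $\varphi(y)=\min_{i=1,2,3}v_i\cdot y$. For $\varepsilon>0$ let $$u^\varepsilon_t(x)=-\varepsilon\log\Big(\frac1{2\pi\varepsilon t}\int_{\mathbb R^2}\exp\Big(-\frac{|x-y|^2}{2\varepsilon t}-\frac{\varphi(y)}{\varepsilon}\Big)\,dy\Big)\qquad(t>0)$$ be the Cole–Hopf solution of $\partial_tu^\varepsilon+\frac12|\nabla u^\varepsilon|^2=\frac\varepsilon2\nabla\cdot\nabla u^\varepsilon$, $u^\varepsilon_0=\varphi$. Let $t\mapsto X^\varepsilon_t(y)$ be the continuous path on $[0,\infty)$ with $X^\varepsilon_0(y)=y$ and $\partial_tX^\varepsilon_t(y)=\nabla u^\varepsilon_t(X^\varepsilon_t(y))$ for $t>0$. Let $X_t(y)=\lim_{\varepsilon\to0^+}X^\varepsilon_t(y)$ be the adhesion-model Lagrangian flow, and let $\rho_t=(X_t)_\sharp\lambda$ be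 the push-forward of Lebesgue measure $\lambda$ under $X_t$. Assume $q\notin\Delta$ and let $t>0$. Let $\tilde T_t$ be a measurable $\mathbb R^2$-valued map, with domain of definition $D\subset\mathbb R^2$, that is defined a.e. in an open set $\Omega$ containing the closed triangle $t(q-\Delta)=\{t(q-p):p\in\Delta\}$. Suppose that for some neighborhood $N$ of the point $tq$: 1. $(\tilde T_t)_\sharp(\lambda|_D)(B)=\rho_t(B)$ for every Borel set $B\subset N$; 2. $\tilde T_t^{-1}(x)=X_t^{-1}(x)$, as sets, for a.e. $x\in N$. Then $\tilde T_t$ is not monotone in any neighborhood of the triangle $t(q-\Delta)$: for every neighborhood $U$ of $t(q-\Delta)$ there are $y,\hat y\in U\cap D$ with $(\tilde T_t(y)-\tilde T_t(\hat y))\cdot(y-\hat y)<0$. Also, $\tilde T_t$ is not the gradient of a convex function there: for no neighborhood $U$ of $t(q-\Delta)$ is there a convex function $\psi$ on $U$ with $\nabla\psi(y)=\tilde T_t(y)$ for a.e. $y\in U\cap D$. -/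

import Mathlib

open MeasureTheory Filter Topology

noncomputable section

/-- The Euclidean plane, with its Euclidean norm, inner product and Lebesgue measure `volume`. -/
abbrev Plane : Type := EuclideanSpace ℝ (Fin 2)

/-- The three-sector velocity potential `φ(y) = min_i v_i · y`, where the `v_i` are the vertices
of the (nondegenerate) triangle `Δ`. -/
def threeSectorPotential (Δ : Affine.Triangle ℝ Plane) (y : Plane) : ℝ :=
  Finset.univ.inf' Finset.univ_nonempty fun i : Fin 3 => inner ℝ (Δ.points i) y

/-- The solution `u^ε_t(x)` of the potential Burgers equation
`∂_t u + |∇u|² / 2 = (ε/2) Laplacian u`, `u(·, 0) = φ`, in the plane,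
given by the Cole-Hopf formula
`u^ε_t(x) = -ε log ((2πεt)⁻¹ ∫ exp (-|x - y|² / (2εt) - φ(y) / ε) dy)`. -/
def burgersPotential (φ : Plane → ℝ) (ε t : ℝ) (x : Plane) : ℝ :=
  -ε * Real.log ((2 * Real.pi * ε * t)⁻¹ *
    ∫ y : Plane, Real.exp (-‖x - y‖ ^ 2 / (2 * ε * t) - φ y / ε))

/-- The viscous velocity `v^ε_t = ∇ u^ε_t`. -/
def burgersVelocity (φ : Plane → ℝ) (ε t : ℝ) (x : Plane) : Plane :=
  gradient (burgersPotential φ ε t) x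

/-- `z` is a path of the viscous velocity field started at `y`: `z(0) = y`, `z` is continuous
on `[0, ∞)`, and `z'(t) = v^ε(z(t), t)` for all `t > 0`. -/
def IsViscousPath (φ : Plane → ℝ) (ε : ℝ) (y : Plane) (z : ℝ → Plane) : Prop :=
  z 0 = y ∧ ContinuousOn z (Set.Ici 0) ∧
    ∀ t : ℝ, 0 < t → HasDerivAt z (burgersVelocity φ ε t (z t)) t

/-- The viscous Lagrangian flow map `X^ε_t(y)`: the position at time `t ≥ 0` of the path of the
velocity field `v^ε` started at `y`. -/
def viscousFlow (φ : Plane → ℝ) (ε t : ℝ) (y : Plane) : Plane :=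
  Classical.epsilon (IsViscousPath φ ε y) t

/-- The Lagrangian flow map of the adhesion model, `X_t(y) = lim_{ε → 0⁺} X^ε_t(y)`. -/
def adhesionFlow (φ : Plane → ℝ) (t : ℝ) (y : Plane) : Plane :=
  limUnder (𝓝[>] (0 : ℝ)) fun ε => viscousFlow φ ε t y

/-- The mass measure `ρ_t`, the push-forward of Lebesgue measure under `X_t`. -/
def adhesionMass (φ : Plane → ℝ) (t : ℝ) : Measure Plane :=
  Measure.map (adhesionFlow φ t) volume

/-- The closed triangle `t (q - Δ)`, where `q` is the circumcenter of `Δ`. -/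
def backTriangle (Δ : Affine.Triangle ℝ Plane) (t : ℝ) : Set Plane :=
  (fun p => t • (Δ.circumcenter - p)) '' convexHull ℝ (Set.range Δ.points)

/-- The map `T`, with domain of definition `D`, is monotone on `U`. -/
def IsMonotoneMapOn (D : Set Plane) (T : Plane → Plane) (U : Set Plane) : Prop :=
  ∀ y ∈ U ∩ D, ∀ y' ∈ U ∩ D, 0 ≤ inner ℝ (T y - T y') (y - y')

/-- The map `T`, with domain of definition `D`, is almost everywhere on `U` the gradient of a
convex function on `U`. -/
def IsConvexGradientOn (D : Set Plane) (T : Plane → Plane) (U : Set Plane) : Prop :=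
  ∃ ψ : Plane → ℝ, ConvexOn ℝ U ψ ∧ ∀ᵐ y, y ∈ U → y ∈ D → HasGradientAt ψ (T y) y

end

/-! Near the triple point `t • q` the inviscid plane splits into three sectors with apex `t • q`.
Points of sector `i` come from free motion, so correctness forces `T (x - t • v i) = x` for almost
every `x` there. As `x` tends to the apex, the preimages tend to the vertices `t • (q - v i)`. If
`T` were monotone, then testing `y = t • (q - p)`, with `p` interior to the triangle, against these
preimages would give `0 ≤ ⟪T y - t • q, v i - p⟫` for every `i`. Since `p` is a strictly positive
combination of the vertices, `T y = t • q`. Thus `T` would send a set of positive area to one point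
(`eq_smul_circumcenter_of_monotone`).

The true flow puts no mass there when `q` lies outside the triangle (`volume_adhesionFlow_eq_smul`).
A line separates `q` from all velocities, so a trajectory meets the moving point `s • q` at most
once. The sets of labels `y` that meet it at time `s` are therefore disjoint, and by scaling all are
null or none is; uncountably many disjoint sets of positive measure cannot exist. Push-forward near
`t • q` gives the contradiction. Gradients of convex functions are monotone off a null set, so both
claims follow from one statement.

These facts about the flow rest on two properties of the viscous potential: it is concave, and it
lies within `ε log 3` of a minimum of three affine functions. An energy estimate then yields
contraction, convergence as `ε → 0`, and free motion in the sectors. -/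

noncomputable section

open Set

/-! ### Cole–Hopf integrals and regularity of the viscous velocity. -/

/-- The unnormalized Cole-Hopf density `exp (-|x - y|² / (2εt) - φ(y) / ε)`. -/
def coleHopfDensity (φ : Plane → ℝ) (ε t : ℝ) (x y : Plane) : ℝ :=
  Real.exp (-‖x - y‖ ^ 2 / (2 * ε * t) - φ y / ε)

/-- The total mass of the Cole-Hopf density. -/
def coleHopfMass (φ : Plane → ℝ) (ε t : ℝ) (x : Plane) : ℝ :=
  ∫ y, coleHopfDensity φ ε t x y

/-- The momentum `∫ (x - y) / t` of the Cole-Hopf density. -/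
def coleHopfMomentum (φ : Plane → ℝ) (ε t : ℝ) (x : Plane) : Plane :=
  ∫ y, (coleHopfDensity φ ε t x y * t⁻¹) • (x - y)

section Regularity

variable {φ : Plane → ℝ} {M : NNReal} {ε : ℝ}

theorem coleHopfDensity_pos (t : ℝ) (x y : Plane) : 0 < coleHopfDensity φ ε t x y :=
  Real.exp_pos _

theorem continuous_coleHopfDensity (hφ : LipschitzWith M φ) (t : ℝ) (x : Plane) :
    Continuous (coleHopfDensity φ ε t x) := by
  have := hφ.continuous
  unfold coleHopfDensity
  fun_prop

theorem continuousAt_coleHopfDensity (hε : 0 < ε) {t : ℝ} (ht : 0 < t) (x y : Plane) :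
    ContinuousAt (fun s => coleHopfDensity φ ε s x y) t := by
  unfold coleHopfDensity
  have : 2 * ε * t ≠ 0 := by positivity
  fun_prop (disch := assumption)

theorem integrable_exp_neg_mul_sq_norm {c : ℝ} (hc : 0 < c) :
    Integrable fun y : Plane => Real.exp (-c * ‖y‖ ^ 2) := by
  have h := GaussianFourier.integrable_cexp_neg_mul_sq_norm_add (V := Plane) (b := (c : ℂ))
    (by simpa using hc) 0 0
  refine h.norm.congr (Eventually.of_forall fun y => ?_)
  simp only [Complex.norm_exp]
  norm_cast
  simp

theorem one_add_sq_le_two_mul_exp {s : ℝ} (hs : 0 ≤ s) : (1 + s) ^ 2 ≤ 2 * Real.exp (1 + s) := by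
  have := Real.quadratic_le_exp_of_nonneg (x := 1 + s) (by positivity)
  nlinarith

/-- A uniform Gaussian bound, for `t` in a compact interval and `x` in a ball. -/
theorem exists_coleHopfDensity_bound (hφ : LipschitzWith M φ) (hε : 0 < ε) {δ : ℝ} (hδ : 0 < δ)
    (T R : ℝ) : ∃ b : Plane → ℝ, Integrable b ∧ ∀ t ∈ Icc δ T, ∀ x : Plane, ‖x‖ ≤ R → ∀ y,
      (1 + ‖x - y‖) ^ 2 * coleHopfDensity φ ε t x y ≤ b y := by
  rcases lt_or_ge T δ with hT | hT
  · exact ⟨0, integrable_zero _ _ _, fun t ht => absurd (ht.1.trans ht.2) (not_le.2 hT)⟩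
  have hT0 : 0 < T := hδ.trans_le hT
  -- `c` is half of `1 / (2εT)`, because `‖x - y‖² ≥ ‖y‖²/2 - R²`. The slope `B` collects the linear
  -- growth from the moment factor and from `φ`; half of `c` is spent absorbing it.
  set c : ℝ := 1 / (4 * ε * T) with hc
  have hc0 : 0 < c := by positivity
  set B : ℝ := 1 + M / ε with hB
  set C : ℝ := 1 + R + R ^ 2 / (2 * ε * δ) + |φ 0| / ε with hC
  refine ⟨fun y => 2 * Real.exp (C + B ^ 2 / (2 * c)) * Real.exp (-(c / 2) * ‖y‖ ^ 2),
    (integrable_exp_neg_mul_sq_norm (by positivity)).const_mul _, ?_⟩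
  intro t ht x hx y
  have ht0 : 0 < t := hδ.trans_le ht.1
  have hR : 0 ≤ R := (norm_nonneg x).trans hx
  have h1 := one_add_sq_le_two_mul_exp (norm_nonneg (x - y))
  have hxy : ‖x - y‖ ≤ R + ‖y‖ := (norm_sub_le x y).trans (by linarith)
  have h2 : ‖y‖ ≤ ‖x‖ + ‖x - y‖ := by
    have := norm_sub_le x (x - y)
    simpa using this
  have h3 : ‖y‖ ^ 2 / 2 - R ^ 2 ≤ ‖x - y‖ ^ 2 := by
    have h4 : ‖y‖ ≤ R + ‖x - y‖ := by linarith
    have h5 : ‖y‖ ^ 2 ≤ (R + ‖x - y‖) ^ 2 := by gcongr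
    nlinarith [sq_nonneg (R - ‖x - y‖)]
  have h6 : -‖x - y‖ ^ 2 / (2 * ε * t) ≤ R ^ 2 / (2 * ε * δ) - c * ‖y‖ ^ 2 := by
    have e1 : -‖x - y‖ ^ 2 / (2 * ε * t) ≤ (R ^ 2 - ‖y‖ ^ 2 / 2) / (2 * ε * t) := by
      gcongr; linarith
    have e2 : R ^ 2 / (2 * ε * t) ≤ R ^ 2 / (2 * ε * δ) := by
      gcongr; exact ht.1
    have e3 : ‖y‖ ^ 2 / 2 / (2 * ε * T) ≤ ‖y‖ ^ 2 / 2 / (2 * ε * t) := by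
      gcongr; exact ht.2
    have e4 : c * ‖y‖ ^ 2 = ‖y‖ ^ 2 / 2 / (2 * ε * T) := by
      rw [hc]; field_simp; ring
    rw [sub_div] at e1
    linarith
  have h7 : -(φ y / ε) ≤ |φ 0| / ε + M / ε * ‖y‖ := by
    have e1 := hφ.dist_le_mul y 0
    rw [Real.dist_eq, dist_zero_right] at e1
    have e2 : -φ y ≤ |φ 0| + M * ‖y‖ := by
      have := neg_abs_le (φ y - φ 0)
      have := neg_abs_le (φ 0)
      linarith
    calc -(φ y / ε) = (-φ y) / ε := by ring
      _ ≤ (|φ 0| + M * ‖y‖) / ε := by gcongr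
      _ = _ := by ring
  have h8 : B * ‖y‖ ≤ c / 2 * ‖y‖ ^ 2 + B ^ 2 / (2 * c) := by
    have e : c / 2 * ‖y‖ ^ 2 + B ^ 2 / (2 * c) - B * ‖y‖ = (c * ‖y‖ - B) ^ 2 / (2 * c) := by
      field_simp; ring
    have : 0 ≤ (c * ‖y‖ - B) ^ 2 / (2 * c) := by positivity
    linarith
  calc (1 + ‖x - y‖) ^ 2 * coleHopfDensity φ ε t x y
      ≤ 2 * Real.exp (1 + ‖x - y‖) * coleHopfDensity φ ε t x y := by
        gcongr; exact (coleHopfDensity_pos t x y).le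
    _ = 2 * Real.exp (1 + ‖x - y‖ + (-‖x - y‖ ^ 2 / (2 * ε * t) - φ y / ε)) := by
        rw [coleHopfDensity, mul_assoc, ← Real.exp_add]
    _ ≤ 2 * Real.exp (C + B ^ 2 / (2 * c) + -(c / 2) * ‖y‖ ^ 2) := by
        refine mul_le_mul_of_nonneg_left (Real.exp_le_exp.2 ?_) zero_le_two
        have : B * ‖y‖ = ‖y‖ + M / ε * ‖y‖ := by rw [hB]; ring
        linarith
    _ = _ := by rw [Real.exp_add (C + B ^ 2 / (2 * c)), ← mul_assoc]

/-- The density and its first two moments are dominated together. -/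
theorem moments_le {s k b : ℝ} (hs : 0 ≤ s) (hk : 0 ≤ k) (h : (1 + s) ^ 2 * k ≤ b) :
    k ≤ b ∧ s * k ≤ b ∧ s ^ 2 * k ≤ b :=
  ⟨by nlinarith [mul_nonneg hs hk, mul_nonneg (sq_nonneg s) hk],
    by nlinarith [mul_nonneg hs hk, mul_nonneg (sq_nonneg s) hk],
    by nlinarith [mul_nonneg hs hk, mul_nonneg (sq_nonneg s) hk]⟩

theorem integrable_coleHopfDensity (hφ : LipschitzWith M φ) (hε : 0 < ε) {t : ℝ} (ht : 0 < t)
    (x : Plane) : Integrable (coleHopfDensity φ ε t x) := by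
  obtain ⟨b, hb, h⟩ := exists_coleHopfDensity_bound hφ hε ht t ‖x‖
  refine hb.mono' (continuous_coleHopfDensity hφ t x).aestronglyMeasurable
    (Eventually.of_forall fun y => ?_)
  rw [Real.norm_of_nonneg (coleHopfDensity_pos t x y).le]
  exact (moments_le (norm_nonneg _) (coleHopfDensity_pos t x y).le
    (h t ⟨le_rfl, le_rfl⟩ x le_rfl y)).1

theorem coleHopfMass_pos (hφ : LipschitzWith M φ) (hε : 0 < ε) {t : ℝ} (ht : 0 < t) (x : Plane) :
    0 < coleHopfMass φ ε t x :=
  integral_exp_pos (integrable_coleHopfDensity hφ hε ht x)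

theorem norm_momentumDensity (t : ℝ) (ht : 0 < t) (x y : Plane) :
    ‖(coleHopfDensity φ ε t x y * t⁻¹) • (x - y)‖ =
      t⁻¹ * (‖x - y‖ * coleHopfDensity φ ε t x y) := by
  rw [norm_smul, Real.norm_of_nonneg
    (mul_nonneg (coleHopfDensity_pos t x y).le (inv_nonneg.2 ht.le))]
  ring

theorem integrable_momentumDensity (hφ : LipschitzWith M φ) (hε : 0 < ε) {t : ℝ} (ht : 0 < t)
    (x : Plane) : Integrable fun y => (coleHopfDensity φ ε t x y * t⁻¹) • (x - y) := by
  obtain ⟨b, hb, h⟩ := exists_coleHopfDensity_bound hφ hε ht t ‖x‖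
  refine (hb.const_mul t⁻¹).mono' ?_ (Eventually.of_forall fun y => ?_)
  · have := continuous_coleHopfDensity (ε := ε) hφ t x
    exact Continuous.aestronglyMeasurable (by fun_prop)
  · rw [norm_momentumDensity t ht]
    gcongr
    exact (moments_le (norm_nonneg _) (coleHopfDensity_pos t x y).le
      (h t ⟨le_rfl, le_rfl⟩ x le_rfl y)).2.1

theorem continuousAt_coleHopfMass (hφ : LipschitzWith M φ) (hε : 0 < ε) {t : ℝ} (ht : 0 < t)
    (x : Plane) : ContinuousAt (fun s => coleHopfMass φ ε s x) t := by
  obtain ⟨b, hb, h⟩ := exists_coleHopfDensity_bound hφ hε (half_pos ht) (2 * t) ‖x‖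
  have hI : ∀ᶠ s in 𝓝 t, s ∈ Icc (t / 2) (2 * t) :=
    Icc_mem_nhds (by linarith) (by linarith)
  refine continuousAt_of_dominated (bound := b)
    (Eventually.of_forall fun s => (continuous_coleHopfDensity hφ s x).aestronglyMeasurable)
    (hI.mono fun s hs => Eventually.of_forall fun y => ?_) hb
    (Eventually.of_forall fun y => continuousAt_coleHopfDensity hε ht x y)
  rw [Real.norm_of_nonneg (coleHopfDensity_pos s x y).le]
  exact (moments_le (norm_nonneg _) (coleHopfDensity_pos s x y).le (h s hs x le_rfl y)).1

theorem continuousAt_coleHopfMomentum (hφ : LipschitzWith M φ) (hε : 0 < ε) {t : ℝ} (ht : 0 < t)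
    (x : Plane) : ContinuousAt (fun s => coleHopfMomentum φ ε s x) t := by
  obtain ⟨b, hb, h⟩ := exists_coleHopfDensity_bound hφ hε (half_pos ht) (2 * t) ‖x‖
  have hI : ∀ᶠ s in 𝓝 t, s ∈ Icc (t / 2) (2 * t) :=
    Icc_mem_nhds (by linarith) (by linarith)
  refine continuousAt_of_dominated (bound := fun y => (t / 2)⁻¹ * b y)
    (Eventually.of_forall fun s => ?_)
    (hI.mono fun s hs => Eventually.of_forall fun y => ?_) (hb.const_mul _)
    (Eventually.of_forall fun y => ?_)
  · have := continuous_coleHopfDensity (ε := ε) hφ s x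
    exact Continuous.aestronglyMeasurable (by fun_prop)
  · have hs0 : 0 < s := (half_pos ht).trans_le hs.1
    rw [norm_momentumDensity s hs0]
    have := (moments_le (norm_nonneg _) (coleHopfDensity_pos s x y).le (h s hs x le_rfl y)).2.1
    have h1 : s⁻¹ ≤ (t / 2)⁻¹ := inv_anti₀ (half_pos ht) hs.1
    have h2 : 0 ≤ ‖x - y‖ * coleHopfDensity φ ε s x y :=
      mul_nonneg (norm_nonneg _) (coleHopfDensity_pos s x y).le
    exact mul_le_mul h1 this h2 (by positivity)
  · exact ((continuousAt_coleHopfDensity hε ht x y).mul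
      (continuousAt_inv₀ ht.ne')).smul continuousAt_const

theorem hasFDerivAt_coleHopfDensity (hε : 0 < ε) {t : ℝ} (ht : 0 < t) (x y : Plane) :
    HasFDerivAt (fun z => coleHopfDensity φ ε t z y)
      ((-(coleHopfDensity φ ε t x y * (ε * t)⁻¹)) • innerSL ℝ (x - y)) x := by
  have h1 : HasFDerivAt (fun z : Plane => ‖z - y‖ ^ 2) (2 • innerSL ℝ (x - y)) x := by
    simpa using ((hasFDerivAt_id x).sub_const y).norm_sq
  have h2 := ((h1.const_mul (-(2 * ε * t)⁻¹)).sub_const (φ y / ε)).exp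
  have e : (fun z => coleHopfDensity φ ε t z y) =
      fun z => Real.exp (-(2 * ε * t)⁻¹ * ‖z - y‖ ^ 2 - φ y / ε) := by
    funext z
    rw [coleHopfDensity]
    congr 2
    ring
  rw [e]
  refine h2.congr_fderiv ?_
  rw [show coleHopfDensity φ ε t x y = _ from congrFun e x]
  ext w
  simp
  field_simp

theorem hasGradientAt_coleHopfMass (hφ : LipschitzWith M φ) (hε : 0 < ε) {t : ℝ} (ht : 0 < t)
    (x : Plane) :
    HasGradientAt (coleHopfMass φ ε t) (-(ε⁻¹ • coleHopfMomentum φ ε t x)) x := by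
  obtain ⟨b, hb, h⟩ := exists_coleHopfDensity_bound hφ hε ht t (‖x‖ + 1)
  have hball : ∀ z ∈ Metric.ball x 1, ‖z‖ ≤ ‖x‖ + 1 := fun z hz => by
    have := norm_le_norm_add_norm_sub x z
    rw [mem_ball_iff_norm] at hz
    linarith [norm_sub_rev x z]
  set F' : Plane → Plane → Plane →L[ℝ] ℝ := fun z y =>
    (-(coleHopfDensity φ ε t z y * (ε * t)⁻¹)) • innerSL ℝ (z - y) with hF'
  have hmeas : AEStronglyMeasurable (F' x) := by
    have := continuous_coleHopfDensity (ε := ε) hφ t x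
    exact Continuous.aestronglyMeasurable (by fun_prop)
  have hbound : ∀ᵐ y, ∀ z ∈ Metric.ball x 1, ‖F' z y‖ ≤ (ε * t)⁻¹ * b y := by
    refine Eventually.of_forall fun y z hz => ?_
    have h0 := coleHopfDensity_pos (φ := φ) (ε := ε) t z y
    rw [hF', norm_smul, innerSL_apply_norm, norm_neg, Real.norm_of_nonneg (by positivity)]
    have := (moments_le (norm_nonneg _) h0.le (h t ⟨le_rfl, le_rfl⟩ z (hball z hz) y)).2.1
    calc _ = (ε * t)⁻¹ * (‖z - y‖ * coleHopfDensity φ ε t z y) := by ring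
      _ ≤ _ := by gcongr
  have key := hasFDerivAt_integral_of_dominated_of_fderiv_le (μ := volume) (𝕜 := ℝ)
    (F := fun z y => coleHopfDensity φ ε t z y) (F' := F')
    (Metric.ball_mem_nhds x one_pos)
    (Eventually.of_forall fun z => (continuous_coleHopfDensity hφ t z).aestronglyMeasurable)
    (integrable_coleHopfDensity hφ hε ht x) hmeas hbound (hb.const_mul _)
    (Eventually.of_forall fun y z _ => hasFDerivAt_coleHopfDensity hε ht z y)
  have hint : Integrable (F' x) :=
    (hb.const_mul _).mono' hmeas (hbound.mono fun y hy => hy x (Metric.mem_ball_self one_pos))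
  rw [hasGradientAt_iff_hasFDerivAt]
  refine key.congr_fderiv ?_
  ext w
  rw [ContinuousLinearMap.integral_apply hint]
  simp only [hF', InnerProductSpace.toDual_apply_apply, inner_neg_left, inner_smul_left,
    smul_apply, innerSL_apply_apply, smul_eq_mul]
  rw [coleHopfMomentum, real_inner_comm, ← integral_inner (integrable_momentumDensity hφ hε ht x),
    ← integral_const_mul, ← integral_neg]
  congr 1
  funext y
  rw [inner_smul_right, real_inner_comm]
  simp only [mul_inv, map_inv₀, conj_trivial]
  ring

/-- The factor `-ε` in front of the logarithm cancels the `-ε⁻¹` from differentiating the Gaussian.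
The velocity is the mean of `(x - y) / t` under the normalized density. -/
theorem hasGradientAt_burgersPotential (hφ : LipschitzWith M φ) (hε : 0 < ε) {t : ℝ} (ht : 0 < t)
    (x : Plane) : HasGradientAt (burgersPotential φ ε t)
      ((coleHopfMass φ ε t x)⁻¹ • coleHopfMomentum φ ε t x) x := by
  have hF := coleHopfMass_pos hφ hε ht x
  have h1 := hasGradientAt_coleHopfMass hφ hε ht x
  rw [hasGradientAt_iff_hasFDerivAt] at h1 ⊢
  have hc : (2 * Real.pi * ε * t)⁻¹ ≠ 0 := by positivity
  have h2 := ((h1.const_mul (2 * Real.pi * ε * t)⁻¹).log (mul_ne_zero hc hF.ne')).const_mul (-ε)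
  refine HasFDerivAt.congr_fderiv h2 ?_
  ext w
  simp
  field_simp

theorem burgersVelocity_eq (hφ : LipschitzWith M φ) (hε : 0 < ε) {t : ℝ} (ht : 0 < t)
    (x : Plane) :
    burgersVelocity φ ε t x = (coleHopfMass φ ε t x)⁻¹ • coleHopfMomentum φ ε t x :=
  (hasGradientAt_burgersPotential hφ hε ht x).gradient

theorem hasGradientAt_burgersVelocity (hφ : LipschitzWith M φ) (hε : 0 < ε) {t : ℝ} (ht : 0 < t)
    (x : Plane) : HasGradientAt (burgersPotential φ ε t) (burgersVelocity φ ε t x) x :=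
  (burgersVelocity_eq hφ hε ht x) ▸ hasGradientAt_burgersPotential hφ hε ht x

theorem continuousAt_burgersVelocity (hφ : LipschitzWith M φ) (hε : 0 < ε) {t : ℝ} (ht : 0 < t)
    (x : Plane) : ContinuousAt (fun s => burgersVelocity φ ε s x) t := by
  have h : (fun s => (coleHopfMass φ ε s x)⁻¹ • coleHopfMomentum φ ε s x) =ᶠ[𝓝 t]
      fun s => burgersVelocity φ ε s x :=
    (eventually_gt_nhds ht).mono fun s hs => (burgersVelocity_eq hφ hε hs x).symm
  exact (((continuousAt_coleHopfMass hφ hε ht x).inv₀ (coleHopfMass_pos hφ hε ht x).ne').smul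
    (continuousAt_coleHopfMomentum hφ hε ht x)).congr h

/-- The derivative in `x` of the momentum density. -/
def momentumDensityDeriv (φ : Plane → ℝ) (ε t : ℝ) (x y : Plane) : Plane →L[ℝ] Plane :=
  (coleHopfDensity φ ε t x y * t⁻¹) • ContinuousLinearMap.id ℝ Plane +
    (t⁻¹ • ((-(coleHopfDensity φ ε t x y * (ε * t)⁻¹)) • innerSL ℝ (x - y))).smulRight (x - y)

theorem hasFDerivAt_momentumDensity (hε : 0 < ε) {t : ℝ} (ht : 0 < t) (x y : Plane) :
    HasFDerivAt (fun z => (coleHopfDensity φ ε t z y * t⁻¹) • (z - y))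
      (momentumDensityDeriv φ ε t x y) x :=
  ((hasFDerivAt_coleHopfDensity hε ht x y).mul_const t⁻¹).smul ((hasFDerivAt_id x).sub_const y)

theorem norm_momentumDensityDeriv_le (hε : 0 < ε) {t : ℝ} (ht : 0 < t) (x y : Plane) :
    ‖momentumDensityDeriv φ ε t x y‖ ≤ t⁻¹ * coleHopfDensity φ ε t x y +
      t⁻¹ * ((ε * t)⁻¹ * (‖x - y‖ ^ 2 * coleHopfDensity φ ε t x y)) := by
  have h0 := coleHopfDensity_pos (φ := φ) (ε := ε) t x y
  refine (norm_add_le _ _).trans ?_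
  rw [ContinuousLinearMap.norm_smulRight_apply, norm_smul, norm_smul, norm_smul,
    innerSL_apply_norm, norm_neg, Real.norm_of_nonneg (by positivity),
    Real.norm_of_nonneg (by positivity), Real.norm_of_nonneg (by positivity)]
  calc _ ≤ coleHopfDensity φ ε t x y * t⁻¹ * 1 +
        t⁻¹ * (coleHopfDensity φ ε t x y * (ε * t)⁻¹ * ‖x - y‖) * ‖x - y‖ := by
          gcongr; exact ContinuousLinearMap.norm_id_le
    _ = _ := by ring

theorem exists_derivative_bounds (hφ : LipschitzWith M φ) (hε : 0 < ε) {δ : ℝ} (hδ : 0 < δ)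
    (T R : ℝ) : ∃ b : Plane → ℝ, Integrable b ∧
      ∀ t ∈ Icc δ T, ∀ x ∈ Metric.closedBall (0 : Plane) R, ∀ y,
        ‖(coleHopfDensity φ ε t x y * t⁻¹) • (x - y)‖ ≤ b y ∧
        ‖(-(coleHopfDensity φ ε t x y * (ε * t)⁻¹)) • innerSL ℝ (x - y)‖ ≤ b y ∧
        ‖momentumDensityDeriv φ ε t x y‖ ≤ b y := by
  obtain ⟨b, hb, h⟩ := exists_coleHopfDensity_bound hφ hε hδ T R
  refine ⟨fun y => (δ⁻¹ + (ε * δ)⁻¹ + δ⁻¹ * (ε * δ)⁻¹) * b y, hb.const_mul _, ?_⟩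
  intro t ht x hx y
  have ht0 : 0 < t := hδ.trans_le ht.1
  have h0 := coleHopfDensity_pos (φ := φ) (ε := ε) t x y
  obtain ⟨m0, m1, m2⟩ :=
    moments_le (norm_nonneg _) h0.le (h t ht x (mem_closedBall_zero_iff.1 hx) y)
  have i1 : t⁻¹ ≤ δ⁻¹ := inv_anti₀ hδ ht.1
  have i2 : (ε * t)⁻¹ ≤ (ε * δ)⁻¹ := inv_anti₀ (by positivity) (by gcongr; exact ht.1)
  have hb0 : 0 ≤ b y := h0.le.trans m0
  have p1 : 0 ≤ δ⁻¹ * b y := by positivity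
  have p2 : 0 ≤ (ε * δ)⁻¹ * b y := by positivity
  have p3 : 0 ≤ δ⁻¹ * ((ε * δ)⁻¹ * b y) := by positivity
  have e : (δ⁻¹ + (ε * δ)⁻¹ + δ⁻¹ * (ε * δ)⁻¹) * b y =
    δ⁻¹ * b y + (ε * δ)⁻¹ * b y + δ⁻¹ * ((ε * δ)⁻¹ * b y) := by ring
  simp only [e]
  refine ⟨?_, ?_, ?_⟩
  · rw [norm_momentumDensity t ht0]
    have : t⁻¹ * (‖x - y‖ * coleHopfDensity φ ε t x y) ≤ δ⁻¹ * b y := by gcongr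
    linarith
  · rw [norm_smul, innerSL_apply_norm, norm_neg, Real.norm_of_nonneg (by positivity)]
    have : (ε * t)⁻¹ * (‖x - y‖ * coleHopfDensity φ ε t x y) ≤ (ε * δ)⁻¹ * b y := by gcongr
    linarith
  · have q1 : t⁻¹ * coleHopfDensity φ ε t x y ≤ δ⁻¹ * b y := by gcongr
    have q2 : t⁻¹ * ((ε * t)⁻¹ * (‖x - y‖ ^ 2 * coleHopfDensity φ ε t x y)) ≤
      δ⁻¹ * ((ε * δ)⁻¹ * b y) := by gcongr
    linarith [norm_momentumDensityDeriv_le (φ := φ) hε ht0 x y]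

/-- A parameter integral of functions with a uniform integrable derivative bound is Lipschitz. -/
theorem norm_integral_sub_integral_le {E : Type*} [NormedAddCommGroup E] [NormedSpace ℝ E]
    {f : Plane → Plane → E} {f' : Plane → Plane → Plane →L[ℝ] E} {b : Plane → ℝ} {s : Set Plane}
    (hs : Convex ℝ s) (hf : ∀ x ∈ s, Integrable (f x)) (hb : Integrable b)
    (hf' : ∀ x ∈ s, ∀ y, HasFDerivAt (fun z => f z y) (f' x y) x)
    (hfb : ∀ x ∈ s, ∀ y, ‖f' x y‖ ≤ b y) {x x' : Plane} (hx : x ∈ s) (hx' : x' ∈ s) :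
    ‖(∫ y, f x y) - ∫ y, f x' y‖ ≤ (∫ y, b y) * ‖x - x'‖ := by
  rw [← integral_sub (hf x hx) (hf x' hx'), ← integral_mul_const]
  exact norm_integral_le_of_norm_le (hb.mul_const _) (Eventually.of_forall fun y =>
    hs.norm_image_sub_le_of_norm_hasFDerivWithin_le
      (fun z hz => (hf' z hz y).hasFDerivWithinAt) (fun z hz => hfb z hz y) hx' hx)

theorem exists_lipschitz_bounds (hφ : LipschitzWith M φ) (hε : 0 < ε) {δ : ℝ} (hδ : 0 < δ)
    (T R : ℝ) : ∃ C : ℝ, ∀ t ∈ Icc δ T, ∀ x ∈ Metric.closedBall (0 : Plane) R,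
      ‖coleHopfMomentum φ ε t x‖ ≤ C ∧ ∀ x' ∈ Metric.closedBall (0 : Plane) R,
      |coleHopfMass φ ε t x - coleHopfMass φ ε t x'| ≤ C * ‖x - x'‖ ∧
      ‖coleHopfMomentum φ ε t x - coleHopfMomentum φ ε t x'‖ ≤ C * ‖x - x'‖ := by
  obtain ⟨b, hb, h⟩ := exists_derivative_bounds hφ hε hδ T R
  refine ⟨∫ y, b y, fun t ht x hx => ?_⟩
  have ht0 : 0 < t := hδ.trans_le ht.1
  refine ⟨norm_integral_le_of_norm_le hb (Eventually.of_forall fun y => (h t ht x hx y).1),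
    fun x' hx' => ⟨?_, ?_⟩⟩
  · exact norm_integral_sub_integral_le (convex_closedBall _ R)
      (fun z _ => integrable_coleHopfDensity hφ hε ht0 z) hb
      (fun z _ y => hasFDerivAt_coleHopfDensity hε ht0 z y)
      (fun z hz y => (h t ht z hz y).2.1) hx hx'
  · exact norm_integral_sub_integral_le (convex_closedBall _ R)
      (fun z _ => integrable_momentumDensity hφ hε ht0 z) hb
      (fun z _ y => hasFDerivAt_momentumDensity hε ht0 z y)
      (fun z hz y => (h t ht z hz y).2.2) hx hx'

theorem exists_coleHopfMass_ge (hφ : LipschitzWith M φ) (hε : 0 < ε) {δ : ℝ} (hδ : 0 < δ)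
    (R : ℝ) : ∃ c > 0, ∀ t, δ ≤ t → ∀ x ∈ Metric.closedBall (0 : Plane) R,
      c ≤ coleHopfMass φ ε t x := by
  -- The worst case over the ball and over times `≥ δ`: the largest possible distance with the
  -- smallest time.
  set g : Plane → ℝ := fun y => Real.exp (-(|R| + ‖y‖) ^ 2 / (2 * ε * δ) - φ y / ε) with hg
  have hgk : ∀ t, δ ≤ t → ∀ x ∈ Metric.closedBall (0 : Plane) |R|, ∀ y,
      g y ≤ coleHopfDensity φ ε t x y := by
    intro t ht x hx y
    have ht0 : 0 < t := hδ.trans_le ht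
    rw [hg, coleHopfDensity]
    refine Real.exp_le_exp.2 (sub_le_sub_right ?_ _)
    rw [neg_div, neg_div, neg_le_neg_iff]
    have : ‖x - y‖ ≤ |R| + ‖y‖ := (norm_sub_le x y).trans
      (by have := mem_closedBall_zero_iff.1 hx; linarith)
    gcongr
  have hgi : Integrable g := by
    refine (integrable_coleHopfDensity hφ hε hδ 0).mono' ?_ (Eventually.of_forall fun y => ?_)
    · have := hφ.continuous
      exact Continuous.aestronglyMeasurable (by fun_prop)
    · rw [Real.norm_of_nonneg (Real.exp_pos _).le]
      exact hgk δ le_rfl 0 (Metric.mem_closedBall_self (abs_nonneg R)) y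
  exact ⟨∫ y, g y, integral_exp_pos hgi, fun t ht x hx => integral_mono hgi
    (integrable_coleHopfDensity hφ hε (hδ.trans_le ht) x)
    (hgk t ht x (Metric.closedBall_subset_closedBall (le_abs_self R) hx))⟩

/-- A quotient whose numerator and denominator are Lipschitz, with the denominator bounded below.
The bounds are established only away from time `0`, which is why paths are later built from positive
starting times. -/
theorem exists_lipschitzOnWith_burgersVelocity (hφ : LipschitzWith M φ) (hε : 0 < ε) {δ : ℝ}
    (hδ : 0 < δ) (T R : ℝ) : ∃ K : NNReal, ∀ t ∈ Icc δ T,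
      LipschitzOnWith K (burgersVelocity φ ε t) (Metric.closedBall 0 R) := by
  obtain ⟨C, hC⟩ := exists_lipschitz_bounds hφ hε hδ T R
  obtain ⟨c, hc0, hc⟩ := exists_coleHopfMass_ge hφ hε hδ R
  refine ⟨Real.toNNReal (C / c + C * C / (c * c)), fun t ht =>
    LipschitzOnWith.of_dist_le_mul fun x hx x' hx' => ?_⟩
  have ht0 : 0 < t := hδ.trans_le ht.1
  rw [dist_eq_norm, dist_eq_norm, burgersVelocity_eq hφ hε ht0, burgersVelocity_eq hφ hε ht0]
  obtain ⟨-, h1⟩ := hC t ht x hx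
  obtain ⟨h2, h3⟩ := h1 x' hx'
  have h4 := (hC t ht x' hx').1
  have hF := hc t ht.1 x hx
  have hF' := hc t ht.1 x' hx'
  set F := coleHopfMass φ ε t x
  set F' := coleHopfMass φ ε t x'
  set P := coleHopfMomentum φ ε t x
  set P' := coleHopfMomentum φ ε t x'
  have hC0 : 0 ≤ C := (norm_nonneg _).trans h4
  have hFp : 0 < F := hc0.trans_le hF
  have hFp' : 0 < F' := hc0.trans_le hF'
  refine le_trans ?_ (mul_le_mul_of_nonneg_right (Real.le_coe_toNNReal _) (norm_nonneg _))
  have e : F⁻¹ • P - F'⁻¹ • P' = F⁻¹ • (P - P') + (F⁻¹ - F'⁻¹) • P' := by module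
  have e2 : |F⁻¹ - F'⁻¹| ≤ C * ‖x - x'‖ / (c * c) := by
    rw [inv_sub_inv hFp.ne' hFp'.ne', abs_div, abs_of_pos (mul_pos hFp hFp'), abs_sub_comm]
    gcongr
  rw [e]
  calc _ ≤ ‖F⁻¹ • (P - P')‖ + ‖(F⁻¹ - F'⁻¹) • P'‖ := norm_add_le _ _
    _ = F⁻¹ * ‖P - P'‖ + |F⁻¹ - F'⁻¹| * ‖P'‖ := by
      rw [norm_smul, norm_smul, Real.norm_of_nonneg (by positivity), Real.norm_eq_abs]
    _ ≤ c⁻¹ * (C * ‖x - x'‖) + C * ‖x - x'‖ / (c * c) * C := by gcongr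
    _ = _ := by ring

end Regularity

/-! ### Concavity and gradient bounds for the viscous potential. -/

/-- The first-order inequality for convex functions. -/
theorem ConvexOn.add_inner_gradient_le {E : Type*} [NormedAddCommGroup E] [InnerProductSpace ℝ E]
    [CompleteSpace E] {U : Set E} {f : E → ℝ} (hf : ConvexOn ℝ U f) {a b g : E} (ha : a ∈ U)
    (hb : b ∈ U) (hg : HasGradientAt f g a) : f a + inner ℝ g (b - a) ≤ f b := by
  have h1 : HasDerivAt (fun s : ℝ => f (AffineMap.lineMap a b s)) (inner ℝ g (b - a)) 0 := by
    have h2 : HasFDerivAt f (InnerProductSpace.toDual ℝ E g) (AffineMap.lineMap a b (0 : ℝ)) := by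
      simpa using hg.hasFDerivAt
    have h3 := h2.comp_hasDerivAt (0 : ℝ) (AffineMap.hasDerivAt_lineMap (a := a) (b := b))
    rw [InnerProductSpace.toDual_apply_apply] at h3
    exact h3
  have h3 := h1.tendsto_slope_zero_right
  have h4 : inner ℝ g (b - a) ≤ f b - f a := by
    refine le_of_tendsto h3 ?_
    have : Ioo (0 : ℝ) 1 ∈ 𝓝[>] (0 : ℝ) := Ioo_mem_nhdsGT one_pos
    filter_upwards [this] with s hs
    have h5 := hf.2 ha hb (sub_nonneg.2 hs.2.le) hs.1.le (sub_add_cancel 1 s)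
    rw [← AffineMap.lineMap_apply_module] at h5
    simp only [zero_add, AffineMap.lineMap_apply_zero, smul_eq_mul] at h5 ⊢
    rw [inv_mul_le_iff₀ hs.1]
    linarith
  linarith

section Potential

variable {φ : Plane → ℝ} {M : NNReal} {ε : ℝ}

theorem coleHopfDensity_sub (t : ℝ) (x z : Plane) : coleHopfDensity φ ε t x (x - z) =
    Real.exp (-‖z‖ ^ 2 / (2 * ε * t) - φ (x - z) / ε) := by
  rw [coleHopfDensity, sub_sub_cancel]

theorem coleHopfMass_eq_integral_sub (t : ℝ) (x : Plane) :
    coleHopfMass φ ε t x = ∫ z, coleHopfDensity φ ε t x (x - z) :=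
  (integral_sub_left_eq_self (coleHopfDensity φ ε t x) volume x).symm

theorem integrable_coleHopfDensity_sub (hφ : LipschitzWith M φ) (hε : 0 < ε) {t : ℝ} (ht : 0 < t)
    (x : Plane) : Integrable fun z => coleHopfDensity φ ε t x (x - z) :=
  (integrable_coleHopfDensity hφ hε ht x).comp_sub_left x

theorem normalized_coleHopfMass_pos (hφ : LipschitzWith M φ) (hε : 0 < ε) {t : ℝ} (ht : 0 < t)
    (x : Plane) : 0 < (2 * Real.pi * ε * t)⁻¹ * coleHopfMass φ ε t x := by
  have := coleHopfMass_pos hφ hε ht x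
  positivity

theorem exp_neg_burgersPotential (hφ : LipschitzWith M φ) (hε : 0 < ε) {t : ℝ} (ht : 0 < t)
    (x : Plane) : Real.exp (-burgersPotential φ ε t x / ε) =
      (2 * Real.pi * ε * t)⁻¹ * coleHopfMass φ ε t x := by
  rw [← Real.exp_log (normalized_coleHopfMass_pos hφ hε ht x)]
  congr 1
  change -(-ε * Real.log ((2 * Real.pi * ε * t)⁻¹ * coleHopfMass φ ε t x)) / ε = _
  field_simp

theorem add_le_burgersPotential_add (hφ : LipschitzWith M φ) (hε : 0 < ε) {t : ℝ} (ht : 0 < t)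
    {h : Plane} {c : ℝ} (hc : ∀ y, φ y + c ≤ φ (y + h)) (x : Plane) :
    burgersPotential φ ε t x + c ≤ burgersPotential φ ε t (x + h) := by
  have h1 : coleHopfMass φ ε t (x + h) ≤ Real.exp (-c / ε) * coleHopfMass φ ε t x := by
    rw [coleHopfMass_eq_integral_sub, coleHopfMass_eq_integral_sub, ← integral_const_mul]
    refine integral_mono (integrable_coleHopfDensity_sub hφ hε ht _)
      ((integrable_coleHopfDensity_sub hφ hε ht _).const_mul _) fun z => ?_
    simp only [coleHopfDensity_sub, ← Real.exp_add]
    refine Real.exp_le_exp.2 ?_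
    have h2 := hc (x - z)
    rw [show x - z + h = x + h - z by abel] at h2
    have h3 : (φ (x - z) + c) / ε ≤ φ (x + h - z) / ε := by gcongr
    rw [add_div] at h3
    rw [neg_div ε c]
    linarith
  have h4 : Real.exp (-burgersPotential φ ε t (x + h) / ε) ≤
      Real.exp (-(burgersPotential φ ε t x + c) / ε) := by
    rw [show -(burgersPotential φ ε t x + c) / ε = -c / ε + -burgersPotential φ ε t x / ε by ring,
      Real.exp_add, exp_neg_burgersPotential hφ hε ht, exp_neg_burgersPotential hφ hε ht,
      mul_left_comm]
    gcongr
  rw [Real.exp_le_exp, div_le_div_iff_of_pos_right hε] at h4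
  linarith

theorem concaveOn_burgersPotential (hφ : LipschitzWith M φ) (hφc : ConcaveOn ℝ univ φ)
    (hε : 0 < ε) {t : ℝ} (ht : 0 < t) : ConcaveOn ℝ univ (burgersPotential φ ε t) := by
  refine ⟨convex_univ, fun a _ b _ p q hp hq hpq => ?_⟩
  set κ := (2 * Real.pi * ε * t)⁻¹ with hκ
  have hκ0 : 0 < κ := by positivity
  set A := burgersPotential φ ε t a with hA
  set B := burgersPotential φ ε t b with hB
  have hFa : κ * coleHopfMass φ ε t a = Real.exp (-A / ε) :=
    (exp_neg_burgersPotential hφ hε ht a).symm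
  have hFb : κ * coleHopfMass φ ε t b = Real.exp (-B / ε) :=
    (exp_neg_burgersPotential hφ hε ht b).symm
  -- Hölder's inequality through Young's: the factors `exp (A / ε)` and `exp (B / ε)` normalize both
  -- masses to the same value, so convexity of `exp` under the integral loses nothing.
  have h1 : coleHopfMass φ ε t (p • a + q • b) ≤ Real.exp (-(p * A + q * B) / ε) *
      (p * (Real.exp (A / ε) * coleHopfMass φ ε t a) +
        q * (Real.exp (B / ε) * coleHopfMass φ ε t b)) := by
    rw [coleHopfMass_eq_integral_sub, coleHopfMass_eq_integral_sub t a,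
      coleHopfMass_eq_integral_sub t b, ← integral_const_mul, ← integral_const_mul,
      ← integral_const_mul, ← integral_const_mul, ← integral_add, ← integral_const_mul]
    rotate_left
    · exact ((integrable_coleHopfDensity_sub hφ hε ht _).const_mul _).const_mul _
    · exact ((integrable_coleHopfDensity_sub hφ hε ht _).const_mul _).const_mul _
    refine integral_mono (integrable_coleHopfDensity_sub hφ hε ht _)
      (((((integrable_coleHopfDensity_sub hφ hε ht _).const_mul _).const_mul _).add
      (((integrable_coleHopfDensity_sub hφ hε ht _).const_mul _).const_mul _)).const_mul _)
      fun z => ?_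
    simp only [coleHopfDensity_sub, ← Real.exp_add]
    have h2 := hφc.2 (mem_univ (a - z)) (mem_univ (b - z)) hp hq hpq
    have e : p • (a - z) + q • (b - z) = p • a + q • b - z := by
      have : z = (p + q) • z := by rw [hpq, one_smul]
      nth_rw 3 [this]
      module
    rw [e, smul_eq_mul, smul_eq_mul] at h2
    set G := -‖z‖ ^ 2 / (2 * ε * t)
    have h3 := convexOn_exp.2 (mem_univ (A / ε + (G - φ (a - z) / ε)))
      (mem_univ (B / ε + (G - φ (b - z) / ε))) hp hq hpq
    simp only [smul_eq_mul] at h3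
    refine le_trans ?_ (mul_le_mul_of_nonneg_left h3 (Real.exp_pos _).le)
    rw [← Real.exp_add, Real.exp_le_exp]
    have h4 : (p * φ (a - z) + q * φ (b - z)) / ε ≤ φ (p • a + q • b - z) / ε := by gcongr
    have h5 : -(p * A + q * B) / ε + (p * (A / ε + (G - φ (a - z) / ε)) +
        q * (B / ε + (G - φ (b - z) / ε))) =
        (p + q) * G - (p * φ (a - z) + q * φ (b - z)) / ε := by ring
    rw [h5, hpq]
    linarith
  have h6 : Real.exp (-burgersPotential φ ε t (p • a + q • b) / ε) ≤
      Real.exp (-(p * A + q * B) / ε) := by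
    rw [exp_neg_burgersPotential hφ hε ht, ← hκ]
    calc _ ≤ κ * (Real.exp (-(p * A + q * B) / ε) *
      (p * (Real.exp (A / ε) * coleHopfMass φ ε t a) +
        q * (Real.exp (B / ε) * coleHopfMass φ ε t b))) := by gcongr
      _ = Real.exp (-(p * A + q * B) / ε) *
      (p * (Real.exp (A / ε) * (κ * coleHopfMass φ ε t a)) +
        q * (Real.exp (B / ε) * (κ * coleHopfMass φ ε t b))) := by ring
      _ = _ := by
        rw [hFa, hFb, ← Real.exp_add, ← Real.exp_add, neg_div ε A, neg_div ε B,
          add_neg_cancel, add_neg_cancel, Real.exp_zero, mul_one, mul_one, hpq, mul_one]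
  rw [Real.exp_le_exp, div_le_div_iff_of_pos_right hε] at h6
  simp only [smul_eq_mul]
  linarith

theorem burgersPotential_le_add_inner (hφ : LipschitzWith M φ) (hφc : ConcaveOn ℝ univ φ)
    (hε : 0 < ε) {t : ℝ} (ht : 0 < t) (a b : Plane) :
    burgersPotential φ ε t b ≤
      burgersPotential φ ε t a + inner ℝ (burgersVelocity φ ε t a) (b - a) := by
  have h1 : HasGradientAt (-burgersPotential φ ε t) (-burgersVelocity φ ε t a) a := by
    have := (hasGradientAt_burgersVelocity hφ hε ht a).hasFDerivAt.neg
    rw [hasGradientAt_iff_hasFDerivAt, map_neg]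
    exact this
  have := (concaveOn_burgersPotential hφ hφc hε ht).neg.add_inner_gradient_le
    (mem_univ a) (mem_univ b) h1
  simp only [Pi.neg_apply, inner_neg_left] at this
  linarith

/-- Concavity bounds the increment along `h` above by the directional derivative at `x`, and the
translation bound gives `c` below. -/
theorem le_inner_burgersVelocity (hφ : LipschitzWith M φ) (hφc : ConcaveOn ℝ univ φ)
    (hε : 0 < ε) {t : ℝ} (ht : 0 < t) {h : Plane} {c : ℝ} (hc : ∀ y, φ y + c ≤ φ (y + h))
    (x : Plane) : c ≤ inner ℝ (burgersVelocity φ ε t x) h := by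
  have h1 := burgersPotential_le_add_inner hφ hφc hε ht x (x + h)
  have h2 := add_le_burgersPotential_add hφ hε ht hc x
  rw [add_sub_cancel_left] at h1
  linarith

theorem norm_burgersVelocity_le (hφ : LipschitzWith M φ) (hφc : ConcaveOn ℝ univ φ)
    (hε : 0 < ε) {t : ℝ} (ht : 0 < t) (x : Plane) : ‖burgersVelocity φ ε t x‖ ≤ M := by
  set v := burgersVelocity φ ε t x with hv
  -- The test direction `-v` turns the lower bound into `‖v‖² ≤ M ‖v‖`.
  have h1 : -(M * ‖v‖) ≤ inner ℝ v (-v) := by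
    refine le_inner_burgersVelocity hφ hφc hε ht (fun y => ?_) x
    have := hφ.dist_le_mul y (y + -v)
    rw [Real.dist_eq, dist_eq_norm, sub_add_cancel_left, neg_neg] at this
    linarith [le_abs_self (φ y - φ (y + -v))]
  rw [inner_neg_right, real_inner_self_eq_norm_sq] at h1
  by_contra! h
  have : 0 < ‖v‖ := M.coe_nonneg.trans_lt h
  nlinarith

theorem inner_burgersVelocity_sub_nonpos (hφ : LipschitzWith M φ) (hφc : ConcaveOn ℝ univ φ)
    (hε : 0 < ε) {t : ℝ} (ht : 0 < t) (a b : Plane) :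
    inner ℝ (burgersVelocity φ ε t a - burgersVelocity φ ε t b) (a - b) ≤ 0 := by
  have h1 := burgersPotential_le_add_inner hφ hφc hε ht a b
  have h2 := burgersPotential_le_add_inner hφ hφc hε ht b a
  rw [← neg_sub a b, inner_neg_right] at h1
  rw [inner_sub_left]
  linarith

end Potential

/-! ### Comparison with the inviscid potential. -/

section ThreeSector

variable (Δ : Affine.Triangle ℝ Plane)

/-- The inviscid potential `min_i (v_i · x - t |v_i|² / 2)`. -/
def inviscidPotential (t : ℝ) (x : Plane) : ℝ :=
  Finset.univ.inf' Finset.univ_nonempty fun i : Fin 3 =>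
    inner ℝ (Δ.points i) x - t * ‖Δ.points i‖ ^ 2 / 2

theorem threeSectorPotential_le (i : Fin 3) (y : Plane) :
    threeSectorPotential Δ y ≤ inner ℝ (Δ.points i) y :=
  Finset.inf'_le _ (Finset.mem_univ i)

theorem exists_threeSectorPotential_eq (y : Plane) :
    ∃ i, threeSectorPotential Δ y = inner ℝ (Δ.points i) y := by
  obtain ⟨i, -, hi⟩ := Finset.exists_mem_eq_inf' Finset.univ_nonempty
    fun i : Fin 3 => inner ℝ (Δ.points i) y
  exact ⟨i, hi⟩

theorem inviscidPotential_le (i : Fin 3) (t : ℝ) (x : Plane) :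
    inviscidPotential Δ t x ≤ inner ℝ (Δ.points i) x - t * ‖Δ.points i‖ ^ 2 / 2 :=
  Finset.inf'_le _ (Finset.mem_univ i)

theorem exists_inviscidPotential_eq (t : ℝ) (x : Plane) :
    ∃ i, inviscidPotential Δ t x = inner ℝ (Δ.points i) x - t * ‖Δ.points i‖ ^ 2 / 2 := by
  obtain ⟨i, -, hi⟩ := Finset.exists_mem_eq_inf' Finset.univ_nonempty
    fun i : Fin 3 => inner ℝ (Δ.points i) x - t * ‖Δ.points i‖ ^ 2 / 2
  exact ⟨i, hi⟩

theorem concaveOn_threeSectorPotential : ConcaveOn ℝ univ (threeSectorPotential Δ) := by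
  refine ⟨convex_univ, fun a _ b _ p q hp hq _ => ?_⟩
  obtain ⟨i, hi⟩ := exists_threeSectorPotential_eq Δ (p • a + q • b)
  rw [hi, inner_add_right, inner_smul_right, inner_smul_right, smul_eq_mul, smul_eq_mul]
  have := threeSectorPotential_le Δ i a
  have := threeSectorPotential_le Δ i b
  gcongr

theorem threeSectorPotential_add_le {h : Plane} {c : ℝ} (hc : ∀ i, c ≤ inner ℝ (Δ.points i) h)
    (y : Plane) : threeSectorPotential Δ y + c ≤ threeSectorPotential Δ (y + h) := by
  obtain ⟨i, hi⟩ := exists_threeSectorPotential_eq Δ (y + h)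
  rw [hi, inner_add_right]
  linarith [threeSectorPotential_le Δ i y, hc i]

theorem exists_lipschitzWith_threeSectorPotential :
    ∃ M : NNReal, LipschitzWith M (threeSectorPotential Δ) := by
  refine ⟨∑ i, ‖Δ.points i‖₊, LipschitzWith.of_le_add_mul _ fun x y => ?_⟩
  have h := threeSectorPotential_add_le Δ (h := y - x) (c := -((∑ i, ‖Δ.points i‖) * ‖y - x‖))
    (fun i => ?_) x
  · rw [add_sub_cancel] at h
    rw [dist_eq_norm, norm_sub_rev]
    push_cast
    linarith
  · have h1 := neg_le_of_abs_le (abs_real_inner_le_norm (Δ.points i) (y - x))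
    have h2 : ‖Δ.points i‖ ≤ ∑ i, ‖Δ.points i‖ :=
      Finset.single_le_sum (f := fun i => ‖Δ.points i‖) (fun _ _ => norm_nonneg _)
        (Finset.mem_univ i)
    have h3 : ‖Δ.points i‖ * ‖y - x‖ ≤ (∑ i, ‖Δ.points i‖) * ‖y - x‖ := by gcongr
    linarith

/-- Completing the square recentres the Gaussian at `x - t • v`. A linear initial potential thus has
an exact affine solution, independent of `ε`. -/
theorem normalized_coleHopfMass_inner {ε t : ℝ} (hε : 0 < ε) (ht : 0 < t) (v x : Plane) :
    (2 * Real.pi * ε * t)⁻¹ * coleHopfMass (fun y => inner ℝ v y) ε t x =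
      Real.exp (-(inner ℝ v x - t * ‖v‖ ^ 2 / 2) / ε) := by
  have h1 : ∀ y, coleHopfDensity (fun y => inner ℝ v y) ε t x y =
      Real.exp (-(inner ℝ v x - t * ‖v‖ ^ 2 / 2) / ε) *
        Real.exp (-(2 * ε * t)⁻¹ * ‖x - t • v - y‖ ^ 2) := by
    intro y
    rw [coleHopfDensity, ← Real.exp_add]
    congr 1
    have e : ‖x - t • v - y‖ ^ 2 =
        ‖x - y‖ ^ 2 - 2 * t * (inner ℝ v x - inner ℝ v y) + t ^ 2 * ‖v‖ ^ 2 := by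
      rw [show x - t • v - y = (x - y) - t • v by abel, norm_sub_sq_real, inner_smul_right,
        norm_smul, mul_pow, Real.norm_eq_abs, sq_abs, real_inner_comm, inner_sub_right]
      ring
    rw [e]
    field_simp
    ring
  have h2 := GaussianFourier.integral_rexp_neg_mul_sq_norm (V := Plane) (b := (2 * ε * t)⁻¹)
    (by positivity)
  rw [coleHopfMass]
  simp_rw [h1]
  rw [integral_const_mul, integral_sub_left_eq_self
    (fun y : Plane => Real.exp (-(2 * ε * t)⁻¹ * ‖y‖ ^ 2)) volume (x - t • v), h2]
  simp
  field_simp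

theorem coleHopfDensity_inner_le {ε t : ℝ} (hε : 0 < ε) (i : Fin 3) (x y : Plane) :
    coleHopfDensity (fun y => inner ℝ (Δ.points i) y) ε t x y ≤
      coleHopfDensity (threeSectorPotential Δ) ε t x y := by
  refine Real.exp_le_exp.2 (sub_le_sub_left ?_ _)
  have := threeSectorPotential_le Δ i y
  gcongr

theorem lipschitzWith_inner (v : Plane) : LipschitzWith ‖v‖₊ fun y : Plane => inner ℝ v y :=
  LipschitzWith.of_dist_le_mul fun x y => by
    rw [Real.dist_eq, ← inner_sub_right, dist_eq_norm]
    exact abs_real_inner_le_norm _ _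

/-- The viscous potential is within `ε log 3` of the inviscid one. -/
theorem abs_burgersPotential_sub_inviscidPotential_le {ε t : ℝ} (hε : 0 < ε) (ht : 0 < t)
    (x : Plane) : |burgersPotential (threeSectorPotential Δ) ε t x - inviscidPotential Δ t x| ≤
      ε * Real.log 3 := by
  obtain ⟨M, hM⟩ := exists_lipschitzWith_threeSectorPotential Δ
  have hint := fun i => integrable_coleHopfDensity (lipschitzWith_inner (Δ.points i)) hε ht x
  have hexp := exp_neg_burgersPotential hM hε ht x
  set κ := (2 * Real.pi * ε * t)⁻¹ with hκ
  have hκ0 : 0 < κ := by positivity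
  set u := burgersPotential (threeSectorPotential Δ) ε t x
  set w := inviscidPotential Δ t x with hw
  -- The density for the minimum is the maximum of the three linear densities, so it lies between
  -- each of them and their sum. The three terms of the sum produce `log 3`.
  have hlow : Real.exp (-w / ε) ≤ Real.exp (-u / ε) := by
    obtain ⟨i, hi⟩ := exists_inviscidPotential_eq Δ t x
    rw [hexp, hw, hi, ← normalized_coleHopfMass_inner hε ht, ← hκ]
    gcongr
    exact integral_mono (hint i) (integrable_coleHopfDensity hM hε ht x)
      (coleHopfDensity_inner_le Δ hε i x)
  have hup : Real.exp (-u / ε) ≤ Real.exp (Real.log 3 + -w / ε) := by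
    rw [Real.exp_add, Real.exp_log (by norm_num), hexp]
    have h1 : coleHopfMass (threeSectorPotential Δ) ε t x ≤
        ∑ i, coleHopfMass (fun y => inner ℝ (Δ.points i) y) ε t x := by
      unfold coleHopfMass
      rw [← integral_finsetSum _ fun i _ => hint i]
      refine integral_mono (integrable_coleHopfDensity hM hε ht x)
        (integrable_finsetSum _ fun i _ => hint i) fun y => ?_
      obtain ⟨i, hi⟩ := exists_threeSectorPotential_eq Δ y
      have h2 : coleHopfDensity (threeSectorPotential Δ) ε t x y =
          coleHopfDensity (fun y => inner ℝ (Δ.points i) y) ε t x y := by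
        rw [coleHopfDensity, coleHopfDensity, hi]
      simp only [h2]
      exact Finset.single_le_sum
        (f := fun i => coleHopfDensity (fun y => inner ℝ (Δ.points i) y) ε t x y)
        (fun i _ => (coleHopfDensity_pos t x y).le) (Finset.mem_univ i)
    calc _ ≤ κ * ∑ i, coleHopfMass (fun y => inner ℝ (Δ.points i) y) ε t x := by gcongr
      _ = ∑ i, Real.exp (-(inner ℝ (Δ.points i) x - t * ‖Δ.points i‖ ^ 2 / 2) / ε) := by
        rw [Finset.mul_sum]
        exact Finset.sum_congr rfl fun i _ => normalized_coleHopfMass_inner hε ht _ _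
      _ ≤ ∑ _i : Fin 3, Real.exp (-w / ε) := by
        refine Finset.sum_le_sum fun i _ => Real.exp_le_exp.2 ?_
        have := inviscidPotential_le Δ i t x
        gcongr
      _ = 3 * Real.exp (-w / ε) := by simp
  rw [Real.exp_le_exp] at hlow hup
  rw [div_le_div_iff_of_pos_right hε] at hlow
  have h3 : (-u / ε) * ε ≤ (Real.log 3 + -w / ε) * ε := by gcongr
  rw [add_mul, div_mul_cancel₀ _ hε.ne', div_mul_cancel₀ _ hε.ne'] at h3
  have h4 : 0 ≤ ε * Real.log 3 := mul_nonneg hε.le (Real.log_nonneg (by norm_num))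
  rw [abs_le]
  constructor <;> linarith

end ThreeSector

/-! ### Existence, uniqueness and contraction of viscous paths. -/

/-- Energy estimate: if `⟪a', a⟫ ≤ η` then `|a|²` grows at most at the rate `2η`. -/
theorem norm_sq_le_of_inner_deriv_le {E : Type*} [NormedAddCommGroup E] [InnerProductSpace ℝ E]
    {a a' : ℝ → E} {s t η : ℝ} (hst : s ≤ t) (hc : ContinuousOn a (Icc s t))
    (hd : ∀ r ∈ Ioo s t, HasDerivAt a (a' r) r) (h : ∀ r ∈ Ioo s t, inner ℝ (a' r) (a r) ≤ η) :
    ‖a t‖ ^ 2 ≤ ‖a s‖ ^ 2 + 2 * η * (t - s) := by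
  have h1 := (convex_Icc s t).image_sub_le_mul_sub_of_deriv_le (f := fun r => ‖a r‖ ^ 2)
    (C := 2 * η) (hc.norm.pow 2) (by
      rw [interior_Icc]
      exact fun r hr => (hd r hr).norm_sq.differentiableAt.differentiableWithinAt) (by
      rw [interior_Icc]
      intro r hr
      have h2 : HasDerivAt (fun r => ‖a r‖ ^ 2) (2 * inner ℝ (a r) (a' r)) r := (hd r hr).norm_sq
      rw [h2.deriv, real_inner_comm]
      linarith [h r hr]) s (left_mem_Icc.2 hst) t (right_mem_Icc.2 hst) hst
  linarith

section Paths

variable {φ : Plane → ℝ} {M : NNReal} {ε : ℝ}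

/-- The viscous flow contracts distances. -/
theorem norm_sub_le_of_viscous (hφ : LipschitzWith M φ) (hφc : ConcaveOn ℝ univ φ)
    (hε : 0 < ε) {z w : ℝ → Plane} {s t : ℝ} (hs : 0 ≤ s) (hst : s ≤ t)
    (hz : ContinuousOn z (Icc s t)) (hw : ContinuousOn w (Icc s t))
    (hz' : ∀ r ∈ Ioo s t, HasDerivAt z (burgersVelocity φ ε r (z r)) r)
    (hw' : ∀ r ∈ Ioo s t, HasDerivAt w (burgersVelocity φ ε r (w r)) r) :
    ‖z t - w t‖ ≤ ‖z s - w s‖ := by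
  have h := norm_sq_le_of_inner_deriv_le (a := fun r => z r - w r) (η := 0) hst (hz.sub hw)
    (fun r hr => (hz' r hr).sub (hw' r hr))
    (fun r hr => inner_burgersVelocity_sub_nonpos hφ hφc hε (hs.trans_lt hr.1) _ _)
  rw [mul_zero, zero_mul, add_zero] at h
  exact le_of_sq_le_sq h (norm_nonneg _)

theorem exists_viscous_path_Icc (hφ : LipschitzWith M φ) (hφc : ConcaveOn ℝ univ φ)
    (hε : 0 < ε) {s t : ℝ} (hs : 0 < s) (hst : s ≤ t) (y : Plane) : ∃ z : ℝ → Plane, z s = y ∧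
      ∀ r ∈ Icc s t, HasDerivWithinAt z (burgersVelocity φ ε r (z r)) (Icc s t) r := by
  have ha : 0 ≤ M * (t - s) := mul_nonneg M.coe_nonneg (sub_nonneg.2 hst)
  -- The speed bound `M` confines the path to radius `M (t - s)`, so one application of
  -- Picard–Lindelöf covers the whole interval.
  obtain ⟨K, hK⟩ := exists_lipschitzOnWith_burgersVelocity hφ hε hs t (‖y‖ + M * (t - s))
  have hsub : Metric.closedBall y (M * (t - s)) ⊆
      Metric.closedBall (0 : Plane) (‖y‖ + M * (t - s)) := by
    apply Metric.closedBall_subset_closedBall'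
    rw [dist_zero_right, add_comm]
  have hpl : IsPicardLindelof (burgersVelocity φ ε) (tmin := s) (tmax := t)
      ⟨s, left_mem_Icc.2 hst⟩ y ⟨M * (t - s), ha⟩ 0 M K :=
    { lipschitzOnWith := fun r hr => (hK r hr).mono hsub
      continuousOn := fun x _ r hr =>
        (continuousAt_burgersVelocity hφ hε (hs.trans_le hr.1) x).continuousWithinAt
      norm_le := fun r hr x _ => norm_burgersVelocity_le hφ hφc hε (hs.trans_le hr.1) x
      mul_max_le := by
        change (M : ℝ) * max (t - s) (s - s) ≤ M * (t - s) - ((0 : NNReal) : ℝ)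
        rw [sub_self, max_eq_left (sub_nonneg.2 hst), NNReal.coe_zero, sub_zero] }
  exact hpl.exists_eq_forall_mem_Icc_hasDerivWithinAt₀

/-- Paths released from `y` at times `δ n → 0` converge: a path released earlier has moved at most
`M δ n` by time `δ n`, and contraction preserves that gap afterwards. -/
theorem exists_isViscousPath (hφ : LipschitzWith M φ) (hφc : ConcaveOn ℝ univ φ)
    (hε : 0 < ε) (y : Plane) : ∃ z, IsViscousPath φ ε y z := by
  set δ : ℕ → ℝ := fun n => 1 / ((n : ℝ) + 1) with hδ
  set τ : ℕ → ℝ := fun n => (n : ℝ) + 2 with hτ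
  have hδ0 : ∀ n, 0 < δ n := fun n => by positivity
  have hδlim : Tendsto δ atTop (𝓝 0) := tendsto_one_div_add_atTop_nhds_zero_nat
  have hδτ : ∀ n, δ n ≤ τ n := fun n => by
    have : δ n ≤ 1 := by
      rw [hδ]
      exact (div_le_one (by positivity)).2 (by linarith [n.cast_nonneg (α := ℝ)])
    have : (1 : ℝ) ≤ τ n := by rw [hτ]; linarith [n.cast_nonneg (α := ℝ)]
    linarith
  have hδanti : ∀ n m, n ≤ m → δ m ≤ δ n := fun n m h => by
    have : (n : ℝ) ≤ m := by exact_mod_cast h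
    rw [hδ]
    exact one_div_le_one_div_of_le (by positivity) (by linarith)
  have hτmono : ∀ n m, n ≤ m → τ n ≤ τ m := fun n m h => by
    have : (n : ℝ) ≤ m := by exact_mod_cast h
    rw [hτ]
    linarith
  choose z hz0 hz' using fun n => exists_viscous_path_Icc hφ hφc hε (hδ0 n) (hδτ n) y
  have hzc : ∀ n, ContinuousOn (z n) (Icc (δ n) (τ n)) := fun n r hr =>
    (hz' n r hr).continuousWithinAt
  have hzd : ∀ n, ∀ r ∈ Ioo (δ n) (τ n), HasDerivAt (z n) (burgersVelocity φ ε r (z n r)) r :=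
    fun n r hr => (hz' n r (Ioo_subset_Icc_self hr)).hasDerivAt (Icc_mem_nhds hr.1 hr.2)
  have hzy : ∀ n, ∀ r ∈ Icc (δ n) (τ n), ‖z n r - y‖ ≤ M * (r - δ n) := fun n r hr => by
    have := norm_image_sub_le_of_norm_deriv_le_segment' (hz' n)
      (fun s hs => norm_burgersVelocity_le hφ hφc hε ((hδ0 n).trans_le hs.1) _) r hr
    rwa [hz0] at this
  have hzz : ∀ n m, n ≤ m → ∀ r ∈ Icc (δ n) (τ n), ‖z n r - z m r‖ ≤ M * δ n := by
    intro n m hnm r hr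
    have i1 := hδanti n m hnm
    have i2 := hτmono n m hnm
    have h1 := norm_sub_le_of_viscous hφ hφc hε (hδ0 n).le hr.1
      ((hzc n).mono (Icc_subset_Icc le_rfl hr.2)) ((hzc m).mono (Icc_subset_Icc i1 (hr.2.trans i2)))
      (fun s hs => hzd n s ⟨hs.1, hs.2.trans_le hr.2⟩)
      (fun s hs => hzd m s ⟨i1.trans_lt hs.1, hs.2.trans_le (hr.2.trans i2)⟩)
    have h2 := hzy m (δ n) ⟨i1, (hδτ n).trans i2⟩
    rw [hz0, norm_sub_rev y] at h1
    have := mul_nonneg M.coe_nonneg (hδ0 m).le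
    linarith
  have hev : ∀ a b, 0 < a → ∀ᶠ n in atTop, Icc a b ⊆ Ioo (δ n) (τ n) := by
    intro a b ha
    have h1 : ∀ᶠ n in atTop, δ n < a := hδlim.eventually (gt_mem_nhds ha)
    have h2 : ∀ᶠ n in atTop, b < τ n := by
      filter_upwards [tendsto_natCast_atTop_atTop.eventually_gt_atTop b] with n hn
      rw [hτ]
      linarith
    filter_upwards [h1, h2] with n hn hn' r hr
    exact ⟨hn.trans_le hr.1, hr.2.trans_lt hn'⟩
  have hlim : ∀ r, 0 < r → ∃ w, Tendsto (fun n => z n r) atTop (𝓝 w) := by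
    intro r hr
    obtain ⟨n₀, hn₀⟩ := eventually_atTop.1 (hev r r hr)
    have hC : CauchySeq fun n => z (n + n₀) r := by
      refine cauchySeq_of_le_tendsto_0' (fun n => M * δ (n + n₀)) (fun n m hnm => ?_) ?_
      · rw [dist_eq_norm]
        exact hzz _ _ (by omega) r
          (Ioo_subset_Icc_self (hn₀ (n + n₀) (by omega) ⟨le_rfl, le_rfl⟩))
      · simpa using ((tendsto_add_atTop_iff_nat n₀).2 hδlim).const_mul (M : ℝ)
    obtain ⟨w, hw⟩ := cauchySeq_tendsto_of_complete hC
    exact ⟨w, (tendsto_add_atTop_iff_nat n₀).1 hw⟩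
  choose! Z hZ using hlim
  have hzZ : ∀ n, ∀ r ∈ Icc (δ n) (τ n), ‖z n r - Z r‖ ≤ M * δ n := by
    intro n r hr
    refine le_of_tendsto (tendsto_const_nhds.sub (hZ r ((hδ0 n).trans_le hr.1))).norm ?_
    filter_upwards [eventually_ge_atTop n] with m hm using hzz n m hm r hr
  have hZy : ∀ r, 0 < r → ‖Z r - y‖ ≤ M * r := by
    intro r hr
    refine le_of_tendsto ((hZ r hr).sub_const y).norm ?_
    filter_upwards [hev r r hr] with n hn
    have h1 := hzy n r (Ioo_subset_Icc_self (hn ⟨le_rfl, le_rfl⟩))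
    have := mul_nonneg M.coe_nonneg (hδ0 n).le
    linarith
  -- On compact time windows away from `0`, the Lipschitz bound in space makes the derivatives
  -- converge uniformly, so the limit satisfies the equation.
  have hZd : ∀ r, 0 < r → HasDerivAt Z (burgersVelocity φ ε r (Z r)) r := by
    intro r hr
    have hrI : r ∈ Ioo (r / 2) (r + 1) := ⟨by linarith, by linarith⟩
    have hIoo : Ioo (r / 2) (r + 1) ⊆ Icc (r / 2) (r + 1) := Ioo_subset_Icc_self
    obtain ⟨K, hK⟩ :=
      exists_lipschitzOnWith_burgersVelocity hφ hε (half_pos hr) (r + 1) (‖y‖ + M * (r + 1))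
    have hball : ∀ w : Plane, ∀ s ∈ Icc (r / 2) (r + 1), ‖w - y‖ ≤ M * s →
        w ∈ Metric.closedBall (0 : Plane) (‖y‖ + M * (r + 1)) := by
      intro w s hs hw
      rw [mem_closedBall_zero_iff]
      have h1 := norm_le_norm_add_norm_sub y w
      rw [norm_sub_rev] at h1
      have h2 : M * s ≤ M * (r + 1) := by gcongr; exact hs.2
      linarith
    refine hasDerivAt_of_tendstoUniformlyOn (l := atTop) (f := z)
      (f' := fun n s => burgersVelocity φ ε s (z n s))
      (g' := fun s => burgersVelocity φ ε s (Z s)) isOpen_Ioo ?_ ?_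
      (fun s hs => hZ s ((half_pos hr).trans hs.1)) hrI
    · rw [Metric.tendstoUniformlyOn_iff]
      intro η hη
      have hsmall : ∀ᶠ n in atTop, K * (M * δ n) < η := by
        have : Tendsto (fun n => K * (M * δ n)) atTop (𝓝 0) := by
          simpa using (hδlim.const_mul (M : ℝ)).const_mul (K : ℝ)
        exact this.eventually (gt_mem_nhds hη)
      filter_upwards [hsmall, hev (r / 2) (r + 1) (half_pos hr)] with n hn hsub s hs
      have hs' := hIoo hs
      have hsn := Ioo_subset_Icc_self (hsub hs')
      have hs0 : 0 < s := (half_pos hr).trans hs.1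
      have b1 := hball _ s hs' (hZy s hs0)
      have b2 := hball (z n s) s hs' ((hzy n s hsn).trans
        (mul_le_mul_of_nonneg_left (sub_le_self s (hδ0 n).le) M.coe_nonneg))
      refine ((hK s hs').dist_le_mul _ b1 _ b2).trans_lt (lt_of_le_of_lt ?_ hn)
      rw [dist_comm, dist_eq_norm]
      gcongr
      exact hzZ n s hsn
    · filter_upwards [hev (r / 2) (r + 1) (half_pos hr)] with n hsub s hs
      exact hzd n s (hsub (hIoo hs))
  refine ⟨fun r => if r ≤ 0 then y else Z r, by simp, ?_, fun r hr => ?_⟩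
  · intro r hr
    rcases eq_or_lt_of_le (show (0 : ℝ) ≤ r from hr) with rfl | hr0
    · rw [ContinuousWithinAt, if_pos le_rfl, tendsto_iff_norm_sub_tendsto_zero]
      have hM : Tendsto (fun r : ℝ => M * r) (𝓝[Ici 0] 0) (𝓝 0) := by
        have : Continuous fun r : ℝ => M * r := by fun_prop
        simpa using (this.tendsto 0).mono_left (nhdsWithin_le_nhds (s := Ici 0))
      refine squeeze_zero' (Eventually.of_forall fun _ => norm_nonneg _) ?_ hM
      filter_upwards [self_mem_nhdsWithin] with s hs
      split_ifs with h
      · simpa using mul_nonneg M.coe_nonneg hs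
      · exact hZy s (not_le.1 h)
    · have h1 : (fun r => if r ≤ 0 then y else Z r) =ᶠ[𝓝 r] Z := by
        filter_upwards [eventually_gt_nhds hr0] with s hs
        exact if_neg (not_le.2 hs)
      exact ((hZd r hr0).continuousAt.congr h1.symm).continuousWithinAt
  · have h1 : (fun r => if r ≤ 0 then y else Z r) =ᶠ[𝓝 r] Z := by
      filter_upwards [eventually_gt_nhds hr] with s hs
      exact if_neg (not_le.2 hs)
    have h2 := (hZd r hr).congr_of_eventuallyEq h1
    simpa [not_le.2 hr] using h2

theorem isViscousPath_viscousFlow (hφ : LipschitzWith M φ) (hφc : ConcaveOn ℝ univ φ)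
    (hε : 0 < ε) (y : Plane) : IsViscousPath φ ε y fun t => viscousFlow φ ε t y :=
  Classical.epsilon_spec (exists_isViscousPath hφ hφc hε y)

theorem norm_viscousPath_sub_le (hφ : LipschitzWith M φ) (hφc : ConcaveOn ℝ univ φ)
    (hε : 0 < ε) {y y' : Plane} {z w : ℝ → Plane} (hz : IsViscousPath φ ε y z)
    (hw : IsViscousPath φ ε y' w) {t : ℝ} (ht : 0 ≤ t) : ‖z t - w t‖ ≤ ‖y - y'‖ := by
  have := norm_sub_le_of_viscous hφ hφc hε le_rfl ht (hz.2.1.mono Icc_subset_Ici_self)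
    (hw.2.1.mono Icc_subset_Ici_self) (fun r hr => hz.2.2 r hr.1) (fun r hr => hw.2.2 r hr.1)
  rwa [hz.1, hw.1] at this

/-- Contraction with equal starting points gives uniqueness, so the chosen path can be identified
with an explicitly constructed one. -/
theorem viscousFlow_eq (hφ : LipschitzWith M φ) (hφc : ConcaveOn ℝ univ φ)
    (hε : 0 < ε) {y : Plane} {z : ℝ → Plane} (hz : IsViscousPath φ ε y z) {t : ℝ} (ht : 0 ≤ t) :
    viscousFlow φ ε t y = z t := by
  have := norm_viscousPath_sub_le hφ hφc hε (isViscousPath_viscousFlow hφ hφc hε y) hz ht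
  rw [sub_self, norm_zero] at this
  exact sub_eq_zero.1 (norm_le_zero_iff.1 this)

end Paths

/-! ### The adhesion flow: inviscid limit, free motion, scaling, absence of an atom. -/

section Adhesion

variable (Δ : Affine.Triangle ℝ Plane)

theorem isViscousPath_threeSector {ε : ℝ} (hε : 0 < ε) (y : Plane) :
    IsViscousPath (threeSectorPotential Δ) ε y
      fun t => viscousFlow (threeSectorPotential Δ) ε t y := by
  obtain ⟨M, hM⟩ := exists_lipschitzWith_threeSectorPotential Δ
  exact isViscousPath_viscousFlow hM (concaveOn_threeSectorPotential Δ) hε y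

/-- An approximate supergradient inequality for the inviscid potential. The error is independent of
the points, so viscous velocities for different `ε` can be compared. -/
theorem inner_burgersVelocity_le {ε t : ℝ} (hε : 0 < ε) (ht : 0 < t) (z w : Plane) :
    inner ℝ (burgersVelocity (threeSectorPotential Δ) ε t z) (z - w) ≤
      inviscidPotential Δ t z - inviscidPotential Δ t w + 2 * (ε * Real.log 3) := by
  obtain ⟨M, hM⟩ := exists_lipschitzWith_threeSectorPotential Δ
  have h1 := burgersPotential_le_add_inner hM (concaveOn_threeSectorPotential Δ) hε ht z w
  have h2 := abs_le.1 (abs_burgersPotential_sub_inviscidPotential_le Δ hε ht z)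
  have h3 := abs_le.1 (abs_burgersPotential_sub_inviscidPotential_le Δ hε ht w)
  rw [← neg_sub z w, inner_neg_right] at h1
  linarith

/-- Adding the supergradient inequalities for the two viscosities, with the points exchanged,
cancels the inviscid terms and leaves only the `log 3` errors. -/
theorem norm_sq_viscousFlow_sub_le {ε ε' t : ℝ} (hε : 0 < ε) (hε' : 0 < ε') (ht : 0 ≤ t)
    (y : Plane) : ‖viscousFlow (threeSectorPotential Δ) ε t y -
      viscousFlow (threeSectorPotential Δ) ε' t y‖ ^ 2 ≤ 4 * (ε + ε') * Real.log 3 * t := by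
  have hz := isViscousPath_threeSector Δ hε y
  have hw := isViscousPath_threeSector Δ hε' y
  have h := norm_sq_le_of_inner_deriv_le (η := 2 * ((ε + ε') * Real.log 3)) ht
    ((hz.2.1.mono Icc_subset_Ici_self).sub (hw.2.1.mono Icc_subset_Ici_self))
    (fun r hr => (hz.2.2 r hr.1).sub (hw.2.2 r hr.1)) (fun r hr => ?_)
  · simp only [Pi.sub_apply, hz.1, hw.1, sub_self, norm_zero, sub_zero] at h
    linarith
  · have h1 := inner_burgersVelocity_le Δ hε hr.1
      (viscousFlow (threeSectorPotential Δ) ε r y) (viscousFlow (threeSectorPotential Δ) ε' r y)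
    have h2 := inner_burgersVelocity_le Δ hε' hr.1
      (viscousFlow (threeSectorPotential Δ) ε' r y) (viscousFlow (threeSectorPotential Δ) ε r y)
    rw [Pi.sub_apply, inner_sub_left]
    rw [← neg_sub, inner_neg_right] at h2
    linarith

theorem tendsto_viscousFlow {t : ℝ} (ht : 0 ≤ t) (y : Plane) :
    Tendsto (fun ε => viscousFlow (threeSectorPotential Δ) ε t y) (𝓝[>] 0)
      (𝓝 (adhesionFlow (threeSectorPotential Δ) t y)) := by
  refine tendsto_nhds_limUnder (cauchy_map_iff_exists_tendsto.1 ?_)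
  rw [Metric.cauchy_iff]
  refine ⟨inferInstance, fun η hη => ?_⟩
  have hlog : 0 ≤ Real.log 3 := Real.log_nonneg (by norm_num)
  -- Chosen so that `8 κ log 3 · t < η²`; the `+ 1` covers `t = 0` and makes the inequality strict.
  set κ : ℝ := η ^ 2 / (8 * (Real.log 3 * t + 1)) with hκ
  have hκ0 : 0 < κ := by positivity
  refine ⟨_, image_mem_map (Ioo_mem_nhdsGT hκ0), ?_⟩
  rintro _ ⟨ε, hε, rfl⟩ _ ⟨ε', hε', rfl⟩
  rw [dist_eq_norm]
  refine lt_of_pow_lt_pow_left₀ 2 hη.le ?_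
  refine (norm_sq_viscousFlow_sub_le Δ hε.1 hε'.1 ht y).trans_lt ?_
  have h1 : κ * (8 * (Real.log 3 * t + 1)) = η ^ 2 := by
    rw [hκ]; field_simp
  have h2 : 4 * (ε + ε') * Real.log 3 * t ≤ 4 * (κ + κ) * Real.log 3 * t := by
    gcongr
    · exact hε.2.le
    · exact hε'.2.le
  nlinarith

theorem continuous_adhesionFlow {t : ℝ} (ht : 0 ≤ t) :
    Continuous (adhesionFlow (threeSectorPotential Δ) t) := by
  obtain ⟨M, hM⟩ := exists_lipschitzWith_threeSectorPotential Δ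
  refine (LipschitzWith.of_dist_le_mul (K := 1) fun y y' => ?_).continuous
  rw [dist_eq_norm, dist_eq_norm, NNReal.coe_one, one_mul]
  refine le_of_tendsto ((tendsto_viscousFlow Δ ht y).sub (tendsto_viscousFlow Δ ht y')).norm ?_
  filter_upwards [self_mem_nhdsWithin] with ε hε
  exact norm_viscousPath_sub_le hM (concaveOn_threeSectorPotential Δ) hε
    (isViscousPath_threeSector Δ hε y) (isViscousPath_threeSector Δ hε y') ht

/-- Particles inside a sector move freely with the velocity of that sector. -/
theorem adhesionFlow_eq_of_mem_sector {t : ℝ} (ht : 0 ≤ t) {y : Plane} {i : Fin 3}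
    (hi : ∀ j, inner ℝ (Δ.points i) (y + t • Δ.points i) - t * ‖Δ.points i‖ ^ 2 / 2 ≤
      inner ℝ (Δ.points j) (y + t • Δ.points i) - t * ‖Δ.points j‖ ^ 2 / 2) :
    adhesionFlow (threeSectorPotential Δ) t y = y + t • Δ.points i := by
  set v := Δ.points i with hv
  -- Along the line, the gap between the affine functions of `i` and `j` grows at rate `‖v i - v j‖²
  -- / 2`. If it is nonpositive at time `t`, it was nonpositive before.
  have hsec : ∀ r ∈ Ioo 0 t, inner ℝ v (y + r • v) - r * ‖v‖ ^ 2 / 2 ≤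
      inviscidPotential Δ r (y + r • v) := by
    intro r hr
    obtain ⟨j, hj⟩ := exists_inviscidPotential_eq Δ r (y + r • v)
    rw [hj]
    have h1 := hi j
    have h2 : 0 ≤ (t - r) * ‖v - Δ.points j‖ ^ 2 :=
      mul_nonneg (sub_nonneg.2 hr.2.le) (sq_nonneg _)
    rw [norm_sub_sq_real, real_inner_comm] at h2
    simp only [inner_add_right, inner_smul_right, real_inner_self_eq_norm_sq] at h1 ⊢
    linarith
  refine tendsto_nhds_unique (tendsto_viscousFlow Δ ht y) ?_
  rw [tendsto_iff_norm_sub_tendsto_zero]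
  have hbound : ∀ᶠ ε in 𝓝[>] (0 : ℝ),
      ‖viscousFlow (threeSectorPotential Δ) ε t y - (y + t • v)‖ ^ 2 ≤
        4 * (ε * Real.log 3) * t := by
    filter_upwards [self_mem_nhdsWithin] with ε hε
    have hz := isViscousPath_threeSector Δ hε y
    have hline : ∀ r : ℝ, HasDerivAt (fun r : ℝ => y + r • v) v r := fun r => by
      simpa using ((hasDerivAt_id r).smul_const v).const_add y
    have h := norm_sq_le_of_inner_deriv_le (η := 2 * (ε * Real.log 3)) ht
      ((hz.2.1.mono Icc_subset_Ici_self).sub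
        (fun r _ => (hline r).continuousAt.continuousWithinAt))
      (fun r hr => (hz.2.2 r hr.1).sub (hline r)) (fun r hr => ?_)
    · simp only [Pi.sub_apply, hz.1, zero_smul, add_zero, sub_self, norm_zero, sub_zero] at h
      linarith
    · set z := viscousFlow (threeSectorPotential Δ) ε r y
      have h1 := inner_burgersVelocity_le Δ hε hr.1 z (y + r • v)
      have h2 := inviscidPotential_le Δ i r z
      have h3 := hsec r hr
      rw [Pi.sub_apply, inner_sub_left, inner_sub_right v]
      linarith
  have hlim : Tendsto (fun ε : ℝ => 4 * (ε * Real.log 3) * t) (𝓝[>] 0) (𝓝 0) := by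
    have : Continuous fun ε : ℝ => 4 * (ε * Real.log 3) * t := by fun_prop
    simpa using (this.tendsto 0).mono_left (nhdsWithin_le_nhds (s := Ioi 0))
  have hsq := squeeze_zero' (Eventually.of_forall fun _ => sq_nonneg _) hbound hlim
  have := hsq.sqrt
  simpa using this

/-- In a direction in which all velocities point, the flow makes uniform progress. -/
theorem inner_adhesionFlow_add_le {m : Plane} {c : ℝ} (hc : ∀ i, c ≤ inner ℝ (Δ.points i) m)
    {s t : ℝ} (hs : 0 ≤ s) (hst : s ≤ t) (y : Plane) :
    inner ℝ (adhesionFlow (threeSectorPotential Δ) s y) m + c * (t - s) ≤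
      inner ℝ (adhesionFlow (threeSectorPotential Δ) t y) m := by
  obtain ⟨M, hM⟩ := exists_lipschitzWith_threeSectorPotential Δ
  refine le_of_tendsto_of_tendsto
    (((tendsto_viscousFlow Δ hs y).inner tendsto_const_nhds).add_const _)
    ((tendsto_viscousFlow Δ (hs.trans hst) y).inner tendsto_const_nhds) ?_
  filter_upwards [self_mem_nhdsWithin] with ε hε
  have hz := isViscousPath_threeSector Δ hε y
  have hd : ∀ r ∈ Ioo s t, HasDerivAt
      (fun r => inner ℝ (viscousFlow (threeSectorPotential Δ) ε r y) m)
      (inner ℝ (burgersVelocity (threeSectorPotential Δ) ε r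
        (viscousFlow (threeSectorPotential Δ) ε r y)) m) r := fun r hr => by
    simpa using (hz.2.2 r (hs.trans_lt hr.1)).inner ℝ (hasDerivAt_const r m)
  have := (convex_Icc s t).mul_sub_le_image_sub_of_le_deriv
    (f := fun r => inner ℝ (viscousFlow (threeSectorPotential Δ) ε r y) m) (C := c)
    ((hz.2.1.mono (Icc_subset_Ici_self.trans (Ici_subset_Ici.2 hs))).inner continuousOn_const)
    (by
      rw [interior_Icc]
      exact fun r hr => (hd r hr).differentiableAt.differentiableWithinAt)
    (by
      rw [interior_Icc]
      intro r hr
      rw [(hd r hr).deriv]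
      exact le_inner_burgersVelocity hM (concaveOn_threeSectorPotential Δ) hε
        (hs.trans_lt hr.1) (threeSectorPotential_add_le Δ hc) _)
    s (left_mem_Icc.2 hst) t (right_mem_Icc.2 hst) hst
  linarith

theorem threeSectorPotential_smul {c : ℝ} (hc : 0 ≤ c) (y : Plane) :
    threeSectorPotential Δ (c • y) = c * threeSectorPotential Δ y := by
  apply le_antisymm
  · obtain ⟨i, hi⟩ := exists_threeSectorPotential_eq Δ y
    rw [hi, ← inner_smul_right]
    exact threeSectorPotential_le Δ i _
  · obtain ⟨i, hi⟩ := exists_threeSectorPotential_eq Δ (c • y)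
    rw [hi, inner_smul_right]
    exact mul_le_mul_of_nonneg_left (threeSectorPotential_le Δ i y) hc

/-- `φ` is homogeneous of degree one. The planar Jacobian `c²` cancels the factor gained by the
normalization `2πεt`. -/
theorem burgersPotential_smul {c : ℝ} (hc : 0 < c) (ε t : ℝ) (x : Plane) :
    burgersPotential (threeSectorPotential Δ) (c * ε) (c * t) (c • x) =
      c * burgersPotential (threeSectorPotential Δ) ε t x := by
  have h1 := Measure.integral_comp_smul (volume : Measure Plane)
    (fun y => Real.exp (-‖c • x - y‖ ^ 2 / (2 * (c * ε) * (c * t)) -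
      threeSectorPotential Δ y / (c * ε))) c
  have h2 : ∀ y : Plane, Real.exp (-‖c • x - c • y‖ ^ 2 / (2 * (c * ε) * (c * t)) -
      threeSectorPotential Δ (c • y) / (c * ε)) =
      Real.exp (-‖x - y‖ ^ 2 / (2 * ε * t) - threeSectorPotential Δ y / ε) := by
    intro y
    rw [← smul_sub, norm_smul, threeSectorPotential_smul Δ hc.le, Real.norm_of_nonneg hc.le,
      mul_div_mul_left _ _ hc.ne', mul_pow, ← mul_neg,
      show 2 * (c * ε) * (c * t) = c ^ 2 * (2 * ε * t) by ring,
      mul_div_mul_left _ _ (pow_ne_zero 2 hc.ne')]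
  simp_rw [h2] at h1
  unfold burgersPotential
  rw [h1, finrank_euclideanSpace_fin, smul_eq_mul, abs_of_pos (by positivity),
    show (2 * Real.pi * (c * ε) * (c * t))⁻¹ = (2 * Real.pi * ε * t)⁻¹ * (c ^ 2)⁻¹ by
      rw [← mul_inv]; ring, ← mul_assoc _ (c ^ 2)⁻¹]
  ring

theorem burgersVelocity_smul {c ε t : ℝ} (hc : 0 < c) (hε : 0 < ε) (ht : 0 < t) (x : Plane) :
    burgersVelocity (threeSectorPotential Δ) (c * ε) (c * t) (c • x) =
      burgersVelocity (threeSectorPotential Δ) ε t x := by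
  obtain ⟨M, hM⟩ := exists_lipschitzWith_threeSectorPotential Δ
  have h1 := (hasGradientAt_burgersVelocity hM (mul_pos hc hε) (mul_pos hc ht) (c • x)).hasFDerivAt
  have h2 : HasFDerivAt (fun x : Plane => c • x) (c • ContinuousLinearMap.id ℝ Plane) x :=
    (hasFDerivAt_id x).const_smul c
  have h3 := (h1.comp x h2).const_mul c⁻¹
  refine (hasGradientAt_burgersVelocity hM hε ht x).unique ?_ |>.symm
  rw [hasGradientAt_iff_hasFDerivAt]
  have e : burgersPotential (threeSectorPotential Δ) ε t = fun x => c⁻¹ *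
      (burgersPotential (threeSectorPotential Δ) (c * ε) (c * t) ∘ fun x => c • x) x := by
    funext z
    rw [Function.comp_apply, burgersPotential_smul Δ hc, inv_mul_cancel_left₀ hc.ne']
  rw [e]
  refine h3.congr_fderiv ?_
  ext w
  simp [hc.ne']

theorem viscousFlow_smul {c ε t : ℝ} (hc : 0 < c) (hε : 0 < ε) (ht : 0 ≤ t) (y : Plane) :
    viscousFlow (threeSectorPotential Δ) (c * ε) (c * t) (c • y) =
      c • viscousFlow (threeSectorPotential Δ) ε t y := by
  obtain ⟨M, hM⟩ := exists_lipschitzWith_threeSectorPotential Δ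
  obtain ⟨h0, hcont, hd⟩ := isViscousPath_threeSector Δ hε y
  have hz : IsViscousPath (threeSectorPotential Δ) (c * ε) (c • y)
      fun s => c • viscousFlow (threeSectorPotential Δ) ε (c⁻¹ * s) y := by
    refine ⟨by simpa using congrArg (c • ·) h0, ?_, fun s hs => ?_⟩
    · refine (hcont.comp (by fun_prop) fun s hs => ?_).const_smul c
      exact mul_nonneg (inv_nonneg.2 hc.le) hs
    · have hs' : 0 < c⁻¹ * s := by positivity
      have h1 : HasDerivAt (fun s : ℝ => c⁻¹ * s) c⁻¹ s := by
        simpa using (hasDerivAt_id s).const_mul c⁻¹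
      have h2 := ((hd _ hs').scomp s h1).const_smul c
      rw [smul_smul, mul_inv_cancel₀ hc.ne', one_smul, ← burgersVelocity_smul Δ hc hε hs',
        mul_inv_cancel_left₀ hc.ne'] at h2
      exact h2
  rw [viscousFlow_eq hM (concaveOn_threeSectorPotential Δ) (mul_pos hc hε) hz
    (mul_nonneg hc.le ht), inv_mul_cancel_left₀ hc.ne']

/-- Replacing `ε` by `c * ε` does not change the limit `ε → 0⁺`, so the viscous scaling loses its
dependence on viscosity. -/
theorem adhesionFlow_smul {c t : ℝ} (hc : 0 < c) (ht : 0 ≤ t) (y : Plane) :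
    adhesionFlow (threeSectorPotential Δ) (c * t) (c • y) =
      c • adhesionFlow (threeSectorPotential Δ) t y := by
  have h1 : Tendsto (fun ε : ℝ => c * ε) (𝓝[>] 0) (𝓝[>] 0) := by
    refine tendsto_nhdsWithin_iff.2 ⟨?_, ?_⟩
    · have : Continuous fun ε : ℝ => c * ε := by fun_prop
      simpa using (this.tendsto 0).mono_left (nhdsWithin_le_nhds (s := Ioi 0))
    · filter_upwards [self_mem_nhdsWithin] with ε hε using mul_pos hc hε
  refine tendsto_nhds_unique ((tendsto_viscousFlow Δ (mul_nonneg hc.le ht) (c • y)).comp h1) ?_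
  refine ((tendsto_viscousFlow Δ ht y).const_smul c).congr' ?_
  filter_upwards [self_mem_nhdsWithin] with ε hε
  exact (viscousFlow_smul Δ hc hε ht y).symm

/-- No mass concentrates at a point moving with a velocity outside the triangle. -/
theorem volume_adhesionFlow_eq_smul {q : Plane} (hq : q ∉ convexHull ℝ (range Δ.points)) {t : ℝ}
    (ht : 0 < t) :
    volume {y | adhesionFlow (threeSectorPotential Δ) t y = t • q} = 0 := by
  set A : Ioi (0 : ℝ) → Set Plane := fun s =>
    {y | adhesionFlow (threeSectorPotential Δ) s y = (s : ℝ) • q} with hA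
  -- In the separating direction every trajectory advances at rate at least `u`, while `s • q` moves
  -- at the smaller rate `f q`; they cannot meet twice.
  obtain ⟨f, u, hfq, hfΔ⟩ := geometric_hahn_banach_point_closed (convex_convexHull ℝ _)
    ((finite_range Δ.points).isCompact_convexHull (𝕜 := ℝ)).isClosed hq
  set m := (InnerProductSpace.toDual ℝ Plane).symm f with hm
  have hfm : ∀ x, f x = inner ℝ x m := fun x => by
    rw [real_inner_comm, hm, InnerProductSpace.toDual_symm_apply]
  have hum : ∀ i, u ≤ inner ℝ (Δ.points i) m := fun i => by
    rw [← hfm]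
    exact (hfΔ _ (subset_convexHull ℝ _ (mem_range_self i))).le
  have hlt : ∀ s r : Ioi (0 : ℝ), s < r → Disjoint (A s) (A r) := by
    intro s r hsr
    rw [Set.disjoint_left]
    intro y hys hyr
    have h1 := inner_adhesionFlow_add_le Δ hum s.2.le (Subtype.coe_le_coe.2 hsr.le) y
    have hys' : adhesionFlow (threeSectorPotential Δ) s y = (s : ℝ) • q := hys
    have hyr' : adhesionFlow (threeSectorPotential Δ) r y = (r : ℝ) • q := hyr
    rw [hys', hyr', inner_smul_left, inner_smul_left, ← hfm] at h1
    simp only [conj_trivial] at h1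
    have h2 : (0 : ℝ) < r - s := sub_pos.2 hsr
    nlinarith
  have hdisj : Pairwise (Function.onFun Disjoint A) := fun s r hsr =>
    (lt_or_gt_of_ne hsr).elim (hlt s r) fun h => (hlt r s h).symm
  have hmeas : ∀ s, MeasurableSet (A s) := fun s =>
    (isClosed_eq (continuous_adhesionFlow Δ s.2.le) continuous_const).measurableSet
  have hcount := Measure.countable_meas_pos_of_disjoint_iUnion (μ := volume) hmeas hdisj
  by_contra hne
  have hpos : 0 < volume (A ⟨t, ht⟩) := pos_iff_ne_zero.2 hne
  -- Dilation by `s / t` carries `A t` into `A s`, so positive measure at one time spreads to all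
  -- times. Countability of the half-line then contradicts its infinite length.
  have hall : {s | 0 < volume (A s)} = univ := by
    refine eq_univ_of_forall fun s => ?_
    have hs : (0 : ℝ) < s := s.2
    set c : ℝ := s / t with hc
    have hc0 : 0 < c := by positivity
    have hct : c * t = s := by rw [hc]; field_simp
    have hsub : A ⟨t, ht⟩ ⊆ (c • ·) ⁻¹' A s := by
      intro y hy
      have hy' : adhesionFlow (threeSectorPotential Δ) t y = t • q := hy
      change adhesionFlow (threeSectorPotential Δ) s (c • y) = (s : ℝ) • q
      rw [← hct, adhesionFlow_smul Δ hc0 ht.le, hy', smul_smul]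
    have h1 := hpos.trans_le (measure_mono hsub)
    rw [Measure.addHaar_preimage_smul _ hc0.ne'] at h1
    exact pos_of_ne_zero (right_ne_zero_of_mul h1.ne')
  rw [hall, countable_univ_iff] at hcount
  have h0 := (countable_coe_iff.1 hcount).measure_zero volume
  simp [Real.volume_Ioi] at h0

end Adhesion

/-! ### Triangle geometry and the failure of monotonicity. -/

section Reconstruction

variable (Δ : Affine.Triangle ℝ Plane)

/-- The vertices of a triangle form an affine basis of the plane. -/
def triangleBasis : AffineBasis (Fin 3) ℝ Plane :=
  ⟨Δ.points, Δ.independent, by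
    rw [Δ.independent.affineSpan_eq_top_iff_card_eq_finrank_add_one]
    simp⟩

theorem triangleBasis_apply (i : Fin 3) : triangleBasis Δ i = Δ.points i := rfl

/-- The open sector at time `t` in which the velocity is the vertex `i`. -/
def openSector (t : ℝ) (i : Fin 3) : Set Plane :=
  {x | ∀ j, j ≠ i → inner ℝ (Δ.points i - Δ.points j) (x - t • Δ.circumcenter) < 0}

theorem isOpen_openSector (t : ℝ) (i : Fin 3) : IsOpen (openSector Δ t i) := by
  have : openSector Δ t i = ⋂ j, ⋂ _ : j ≠ i,
      {x | inner ℝ (Δ.points i - Δ.points j) (x - t • Δ.circumcenter) < 0} := by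
    ext x
    simp [openSector]
  rw [this]
  exact isOpen_iInter_of_finite fun j => isOpen_iInter_of_finite fun _ =>
    isOpen_lt (by fun_prop) continuous_const

theorem smul_circumcenter_mem_closure_openSector (t : ℝ) (i : Fin 3) :
    t • Δ.circumcenter ∈ closure (openSector Δ t i) := by
  -- The `i`-th barycentric coordinate drops by exactly `1` from vertex `i` to any other vertex, so
  -- moving from the apex along `-h` satisfies all the sector inequalities strictly.
  set L := ((triangleBasis Δ).coord i).linear.toContinuousLinearMap with hL
  set h := (InnerProductSpace.toDual ℝ Plane).symm L with hh
  have hLh : ∀ x, inner ℝ x h = L x := fun x => by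
    rw [real_inner_comm, hh, InnerProductSpace.toDual_symm_apply]
  have hlim : Tendsto (fun s : ℝ => t • Δ.circumcenter - s • h) (𝓝[>] 0)
      (𝓝 (t • Δ.circumcenter)) := by
    have : Continuous fun s : ℝ => t • Δ.circumcenter - s • h := by fun_prop
    simpa using (this.tendsto 0).mono_left (nhdsWithin_le_nhds (s := Ioi 0))
  refine mem_closure_of_tendsto hlim ?_
  filter_upwards [self_mem_nhdsWithin] with s hs j hj
  have h1 : L (Δ.points i - Δ.points j) = 1 := by
    have := ((triangleBasis Δ).coord i).linearMap_vsub (Δ.points i) (Δ.points j)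
    rw [← triangleBasis_apply, ← triangleBasis_apply, AffineBasis.coord_apply_eq,
      AffineBasis.coord_apply_ne _ hj.symm] at this
    rw [triangleBasis_apply, triangleBasis_apply] at this
    simpa only [hL, LinearMap.coe_toContinuousLinearMap', vsub_eq_sub, sub_zero] using this
  rw [sub_sub_cancel_left, inner_neg_right, inner_smul_right, hLh, h1]
  have : 0 < s := hs
  linarith

/-- Equidistance from the circumcenter makes the three affine branches agree at `t • q`. The sector
inequalities therefore say exactly that branch `i` is the smallest at `x`. -/
theorem adhesionFlow_of_mem_openSector {t : ℝ} (ht : 0 ≤ t) {i : Fin 3} {x : Plane}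
    (hx : x ∈ openSector Δ t i) :
    adhesionFlow (threeSectorPotential Δ) t (x - t • Δ.points i) = x := by
  have h := adhesionFlow_eq_of_mem_sector Δ ht (y := x - t • Δ.points i) (i := i) fun j => ?_
  · rwa [sub_add_cancel] at h
  · rw [sub_add_cancel]
    rcases eq_or_ne j i with rfl | hj
    · exact le_rfl
    have h1 := hx j hj
    have h2 : ‖Δ.points i - Δ.circumcenter‖ ^ 2 = ‖Δ.points j - Δ.circumcenter‖ ^ 2 := by
      rw [← dist_eq_norm, ← dist_eq_norm, Δ.dist_circumcenter_eq_circumradius,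
        Δ.dist_circumcenter_eq_circumradius]
    rw [norm_sub_sq_real, norm_sub_sq_real] at h2
    have h3 : t * (‖Δ.points i‖ ^ 2 - 2 * inner ℝ (Δ.points i) Δ.circumcenter) =
        t * (‖Δ.points j‖ ^ 2 - 2 * inner ℝ (Δ.points j) Δ.circumcenter) := by
      congr 1
      linarith
    simp only [inner_sub_left, inner_sub_right, inner_smul_right] at h1
    linarith

/-- The open triangle `t (q - int Δ)`. -/
def openBackTriangle (t : ℝ) : Set Plane :=
  {y | Δ.circumcenter - t⁻¹ • y ∈ interior (convexHull ℝ (range Δ.points))}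

theorem openBackTriangle_subset {t : ℝ} (ht : 0 < t) : openBackTriangle Δ t ⊆ backTriangle Δ t :=
  fun y hy => ⟨Δ.circumcenter - t⁻¹ • y, interior_subset hy, by
    simp [smul_smul, ht.ne']⟩

theorem volume_openBackTriangle_pos {t : ℝ} (ht : 0 < t) : 0 < volume (openBackTriangle Δ t) := by
  have hopen : IsOpen (openBackTriangle Δ t) :=
    isOpen_interior.preimage (f := fun y => Δ.circumcenter - t⁻¹ • y) (by fun_prop)
  refine hopen.measure_pos volume ?_
  have hne := (triangleBasis Δ).centroid_mem_interior_convexHull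
  set p := Finset.univ.centroid ℝ (triangleBasis Δ)
  refine ⟨t • (Δ.circumcenter - p), ?_⟩
  change Δ.circumcenter - t⁻¹ • t • (Δ.circumcenter - p) ∈
    interior (convexHull ℝ (range Δ.points))
  rw [inv_smul_smul₀ ht.ne', sub_sub_cancel]
  exact hne

/-- A vector making nonnegative inner products with all `v_i - p`, for `p` interior to the triangle
`v`, vanishes. -/
theorem eq_zero_of_inner_nonneg {p w : Plane} (hp : p ∈ interior (convexHull ℝ (range Δ.points)))
    (hw : ∀ i, 0 ≤ inner ℝ w (Δ.points i - p)) : w = 0 := by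
  set b := triangleBasis Δ with hb
  have hpos : ∀ i, 0 < b.coord i p := by
    have h := b.interior_convexHull
    have hp' : p ∈ interior (convexHull ℝ (range b)) := hp
    rw [h] at hp'
    exact hp'
  have hcomb : ∀ x, inner ℝ w x = ∑ i, b.coord i x * inner ℝ w (Δ.points i) := fun x => by
    conv_lhs => rw [← b.linear_combination_coord_eq_self x, inner_sum]
    simp_rw [inner_smul_right]
    rfl
  have hsum : ∑ i, b.coord i p * inner ℝ w (Δ.points i - p) = 0 := by
    simp_rw [inner_sub_right, mul_sub]
    rw [Finset.sum_sub_distrib, ← hcomb, ← Finset.sum_mul, b.sum_coord_apply_eq_one, one_mul,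
      sub_self]
  have hzero : ∀ i, inner ℝ w (Δ.points i) = inner ℝ w p := fun i => by
    have h1 := (Finset.sum_eq_zero_iff_of_nonneg
      fun i _ => mul_nonneg (hpos i).le (hw i)).1 hsum i (Finset.mem_univ i)
    have h2 := (mul_eq_zero.1 h1).resolve_left (hpos i).ne'
    rwa [inner_sub_right, sub_eq_zero] at h2
  -- Pairing with `w` is constant on the vertices, hence on the whole plane; evaluating at `p + w`
  -- gives `⟪w, w⟫ = 0`.
  have h3 : inner ℝ w (p + w) = inner ℝ w p := by
    rw [hcomb]
    simp_rw [hzero]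
    rw [← Finset.sum_mul, b.sum_coord_apply_eq_one, one_mul]
  rw [inner_add_right, add_eq_left] at h3
  exact inner_self_eq_zero.1 h3

theorem adhesionMass_singleton (hΔ : Δ.circumcenter ∉ convexHull ℝ (range Δ.points)) {t : ℝ}
    (ht : 0 < t) :
    adhesionMass (threeSectorPotential Δ) t {t • Δ.circumcenter} = 0 := by
  rw [adhesionMass, Measure.map_apply (continuous_adhesionFlow Δ ht.le).measurable
    (measurableSet_singleton _)]
  exact volume_adhesionFlow_eq_smul Δ hΔ ht

/-- A map that reconstructs the flow correctly near the triple point and is monotone off a null set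
collapses the open triangle `t (q - Δ)` to the triple point. -/
theorem eq_smul_circumcenter_of_monotone {t : ℝ} (ht : 0 < t) {D : Set Plane} {T : Plane → Plane}
    {N : Set Plane} (hN : N ∈ 𝓝 (t • Δ.circumcenter))
    (hcorrect : ∀ᵐ x : Plane, x ∈ N →
      {y | y ∈ D ∧ T y = x} = {y | adhesionFlow (threeSectorPotential Δ) t y = x})
    {E : Set Plane} (hE : volume E = 0) {U : Set Plane} (hU : U ∈ 𝓝ˢ (backTriangle Δ t))
    (hmono : IsMonotoneMapOn (D \ E) T U) {y : Plane} (hy : y ∈ openBackTriangle Δ t)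
    (hyD : y ∈ D \ E) : T y = t • Δ.circumcenter := by
  set q := Δ.circumcenter with hq
  have hyU : y ∈ U := subset_of_mem_nhdsSet hU (openBackTriangle_subset Δ ht hy)
  -- Correctness holds only almost everywhere, but the sector meets every neighborhood of its apex
  -- in a nonempty open set. Good points therefore accumulate at the apex.
  have hfreq : ∀ i, ∃ᶠ x in 𝓝 (t • q), x - t • Δ.points i ∈ D \ E ∧ T (x - t • Δ.points i) = x := by
    intro i hnot
    have hae : ∀ᵐ x : Plane, x - t • Δ.points i ∉ E :=
      (measurePreserving_sub_right volume (t • Δ.points i)).quasiMeasurePreserving.ae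
        (measure_eq_zero_iff_ae_notMem.1 hE)
    obtain ⟨O, hO, hOopen, hqO⟩ := mem_nhds_iff.1 (inter_mem hnot hN)
    have hpos : 0 < volume (O ∩ openSector Δ t i) := by
      refine (hOopen.inter (isOpen_openSector Δ t i)).measure_pos volume ?_
      exact mem_closure_iff.1 (smul_circumcenter_mem_closure_openSector Δ t i) O hOopen hqO
    obtain ⟨x, hx, h1, h2⟩ : ∃ x ∈ O ∩ openSector Δ t i, (x ∈ N →
        {y | y ∈ D ∧ T y = x} = {y | adhesionFlow (threeSectorPotential Δ) t y = x}) ∧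
        x - t • Δ.points i ∉ E := by
      by_contra! hcon
      refine hpos.ne' (measure_mono_null (fun x hx => ?_) (hcorrect.and hae))
      exact fun h => h.2 (hcon x hx h.1)
    have hx' := hO hx.1
    have h3 : x - t • Δ.points i ∈ {y | y ∈ D ∧ T y = x} := by
      rw [h1 hx'.2]
      exact adhesionFlow_of_mem_openSector Δ ht.le hx.2
    exact hx'.1 ⟨⟨h3.1, h2⟩, h3.2⟩
  have hineq : ∀ i, 0 ≤ inner ℝ (T y - t • q) (Δ.points i - (q - t⁻¹ • y)) := by
    intro i
    have hUi : ∀ᶠ x in 𝓝 (t • q), x - t • Δ.points i ∈ U := by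
      have h1 : t • q - t • Δ.points i ∈ backTriangle Δ t :=
        ⟨Δ.points i, subset_convexHull ℝ _ (mem_range_self i), smul_sub _ _ _⟩
      have h2 : ContinuousAt (fun x : Plane => x - t • Δ.points i) (t • q) := by fun_prop
      exact h2 (mem_nhdsSet_iff_forall.1 hU _ h1)
    -- Monotonicity is passed to the limit at the vertex. `T` need not be continuous, since its
    -- values at the chosen preimages are the points `x` themselves.
    have hle : 0 ≤ inner ℝ (T y - t • q) (y - (t • q - t • Δ.points i)) := by
      by_contra! hneg
      have hcont : Continuous fun x : Plane => inner ℝ (T y - x) (y - (x - t • Δ.points i)) := by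
        fun_prop
      have hev := hcont.continuousAt.eventually (gt_mem_nhds hneg)
      obtain ⟨x, ⟨hxD, hxT⟩, hxU, hxneg⟩ := ((hfreq i).and_eventually (hUi.and hev)).exists
      have := hmono y ⟨hyU, hyD⟩ _ ⟨hxU, hxD⟩
      rw [hxT] at this
      exact absurd hxneg (not_lt.2 this)
    have e : y - (t • q - t • Δ.points i) = t • (Δ.points i - (q - t⁻¹ • y)) := by
      rw [smul_sub, smul_sub, smul_inv_smul₀ ht.ne']
      abel
    rw [e, inner_smul_right] at hle
    exact nonneg_of_mul_nonneg_right hle ht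
  exact sub_eq_zero.1 (eq_zero_of_inner_nonneg Δ hy hineq)

/-- The null set `E` lets one argument serve both conclusions: it is empty for monotone maps, and
for convex gradients it discards the points where `T` is not the gradient. -/
theorem not_isMonotoneMapOn_diff_null
    (hΔ : Δ.circumcenter ∉ convexHull ℝ (range Δ.points)) {t : ℝ} (ht : 0 < t)
    {Ω : Set Plane} (hsub : backTriangle Δ t ⊆ Ω) {D : Set Plane} (hD : volume (Ω \ D) = 0)
    {T : Plane → Plane} (hT : AEMeasurable T (volume.restrict D))
    {N : Set Plane} (hN : N ∈ 𝓝 (t • Δ.circumcenter))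
    (hpush : ∀ B ⊆ N, MeasurableSet B →
      Measure.map T (volume.restrict D) B = adhesionMass (threeSectorPotential Δ) t B)
    (hcorrect : ∀ᵐ x : Plane, x ∈ N →
      {y | y ∈ D ∧ T y = x} = {y | adhesionFlow (threeSectorPotential Δ) t y = x})
    {E : Set Plane} (hE : volume E = 0) {U : Set Plane} (hU : U ∈ 𝓝ˢ (backTriangle Δ t)) :
    ¬ IsMonotoneMapOn (D \ E) T U := by
  intro hmono
  have h1 := hpush {t • Δ.circumcenter} (singleton_subset_iff.2 (mem_of_mem_nhds hN))
    (measurableSet_singleton _)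
  rw [adhesionMass_singleton Δ hΔ ht,
    Measure.map_apply_of_aemeasurable hT (measurableSet_singleton _)] at h1
  -- The left side has positive area, while the right side is the fibre over the triple point, which
  -- push-forward makes null.
  have h2 : openBackTriangle Δ t \ (Ω \ D ∪ E) ⊆ T ⁻¹' {t • Δ.circumcenter} ∩ D := by
    rintro y ⟨hy, hyn⟩
    have hyΩ : y ∈ Ω := hsub (openBackTriangle_subset Δ ht hy)
    have hyD : y ∈ D := by
      by_contra h
      exact hyn (Or.inl ⟨hyΩ, h⟩)
    have hyE : y ∉ E := fun h => hyn (Or.inr h)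
    exact ⟨eq_smul_circumcenter_of_monotone Δ ht hN hcorrect hE hU hmono hy ⟨hyD, hyE⟩, hyD⟩
  have h3 := volume_openBackTriangle_pos Δ ht
  rw [← measure_sdiff_null (measure_union_null hD hE)] at h3
  exact absurd h1 (h3.trans_le ((measure_mono h2).trans (Measure.le_restrict_apply _ _))).ne'

theorem IsConvexGradientOn.exists_isMonotoneMapOn {D U : Set Plane} {T : Plane → Plane}
    (h : IsConvexGradientOn D T U) : ∃ E, volume E = 0 ∧ IsMonotoneMapOn (D \ E) T U := by
  obtain ⟨ψ, hψ, hae⟩ := h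
  refine ⟨_, hae, fun y hy y' hy' => ?_⟩
  have hg := not_not.1 hy.2.2 hy.1 hy.2.1
  have hg' := not_not.1 hy'.2.2 hy'.1 hy'.2.1
  have h1 := hψ.add_inner_gradient_le hy.1 hy'.1 hg
  have h2 := hψ.add_inner_gradient_le hy'.1 hy.1 hg'
  rw [← neg_sub y y', inner_neg_right] at h1
  rw [inner_sub_left]
  linarith

end Reconstruction

end

theorem mainTheorem4
    (Δ : Affine.Triangle ℝ Plane)
    (hΔ : Δ.circumcenter ∉ convexHull ℝ (Set.range Δ.points))
    (t : ℝ) (ht : 0 < t)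
    -- `T` is a map with domain of definition `D`, containing almost every point of `Ω`
    (Ω : Set Plane) (hΩ : IsOpen Ω) (hsub : backTriangle Δ t ⊆ Ω)
    (D : Set Plane) (hD : volume (Ω \ D) = 0)
    (T : Plane → Plane) (hT : AEMeasurable T (volume.restrict D))
    (N : Set Plane) (hN : N ∈ 𝓝 (t • Δ.circumcenter))
    -- push-forward property for Borel sets in the neighborhood `N` of the triple point
    (hpush : ∀ B ⊆ N, MeasurableSet B →
      Measure.map T (volume.restrict D) B = adhesionMass (threeSectorPotential Δ) t B)
    -- correct reconstruction at almost every `x` in `N`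
    (hcorrect : ∀ᵐ x : Plane, x ∈ N →
      {y | y ∈ D ∧ T y = x} = {y | adhesionFlow (threeSectorPotential Δ) t y = x}) :
    (∀ U ∈ 𝓝ˢ (backTriangle Δ t), ¬ IsMonotoneMapOn D T U) ∧
    (∀ U ∈ 𝓝ˢ (backTriangle Δ t), ¬ IsConvexGradientOn D T U) := by
  refine ⟨fun U hU hmono => ?_, fun U hU hgrad => ?_⟩
  · refine not_isMonotoneMapOn_diff_null Δ hΔ ht hsub hD hT hN hpush hcorrect
      (E := ∅) measure_empty hU ?_
    rwa [Set.sdiff_empty]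
  · obtain ⟨E, hE, hmono⟩ := hgrad.exists_isMonotoneMapOn
    exact not_isMonotoneMapOn_diff_null Δ hΔ ht hsub hD hT hN hpush hcorrect hE hU hmono
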